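/- Let $k$ be a field of characteristic different from $2$ and let $n\ge 2$. Let $V$ be the $k$-vector space with basis $\{x_{ij} \mid 1\le i<j\le n\}$, and let $R\subseteq V\otimes V$ be the subspace spanned by the elements $$x_{ij}x_{jk}-x_{jk}x_{ik}-x_{ik}x_{ij},\qquad x_{jk}x_{ij}-x_{ik}x_{jk}-x_{ij}x_{ik}\qquad (1\le i<j<k\le n),$$ $$x_{ab}x_{uv}-x_{uv}x_{ab}\qquad (1\le a<b\le n,\ 1\le u<v\le n,\ \{a,b\}\cap\{u,v\}=\varnothing).$$ Then the quadratic algebra $\mathscr A(\mathcal{DL}ie,n)=T(V)/(R)$ is Koszul. Here a quadratic algebra $A=T(V)/(R)$, with its weight grading $A=\bigoplus_{j\ge0}A_j$ ($A_j$ being the image of $V^{\otimes j}$) and augmentation ideal $\bar A=\bigoplus_{j\ge1}A_j$, is called Koszul if the homology of its bar construction $B_p(A)=\bar A^{\otimes p}$, with differential $d[a_1|\cdots|a_p]=\sum_{i=1}^{p-1}(-1)^{i-1}[a_1|\cdots|a_ia_{i+1}|\cdots|a_p]$, is concentrated on the diagonal: for all $p$ and all $j\ne p$ the part of weight $j$ of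 $H_p(B(A))$ vanishes. -/

import Mathlib

open scoped TensorProduct

universe u

/-! ### The bar construction of an augmented algebra -/

namespace BarConstruction

variable {k : Type u} [Field k] {A : Type u} [Ring A] [Algebra k A]

/-- The augmentation ideal `Ā`, the kernel of the augmentation `ε : A → k`. -/
abbrev augIdeal (ε : A →ₐ[k] k) : Submodule k A := LinearMap.ker ε.toLinearMap

/-- The product `Ā ⊗ Ā → Ā`. -/
noncomputable def augMul (ε : A →ₐ[k] k) : augIdeal ε ⊗[k] augIdeal ε →ₗ[k] augIdeal ε :=
  LinearMap.codRestrict (augIdeal ε)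
    (TensorProduct.lift
      ((LinearMap.mul k A).compl₁₂ (augIdeal ε).subtype (augIdeal ε).subtype))
    (fun t => by
      induction t with
      | zero => simp
      | tmul x y =>
        have hx : ε x = 0 := x.2
        simp [hx]
      | add x y hx hy => rw [map_add]; exact Submodule.add_mem _ hx hy)

/-- The component `B_p = Ā ⊗ (Ā ⊗ ⋯ (Ā ⊗ k))`, with `p` factors `Ā`, of the bar construction. -/
noncomputable def bar (ε : A →ₐ[k] k) : ℕ → ModuleCat.{u} k
  | 0 => ModuleCat.of k k
  | p + 1 => ModuleCat.of k (augIdeal ε ⊗[k] bar ε p)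

/-- The element `[a | x] = a ⊗ x` of `B_{p+1}`, for `a` in `Ā` and `x` in `B_p`. -/
noncomputable def cons (ε : A →ₐ[k] k) {p : ℕ} (a : augIdeal ε) (x : bar ε p) : bar ε (p + 1) :=
  (a ⊗ₜ[k] x : augIdeal ε ⊗[k] bar ε p)

/-- The map `B_{p+2} → B_{p+1}`, `a ⊗ (b ⊗ x) ↦ ab ⊗ x`. -/
noncomputable def mulHead (ε : A →ₐ[k] k) (p : ℕ) : bar ε (p + 2) →ₗ[k] bar ε (p + 1) :=
  ((augMul ε).rTensor (bar ε p) ∘ₗ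
      (TensorProduct.assoc k (augIdeal ε) (augIdeal ε) (bar ε p)).symm.toLinearMap :
    augIdeal ε ⊗[k] (augIdeal ε ⊗[k] bar ε p) →ₗ[k] augIdeal ε ⊗[k] bar ε p)

/-- The map `id ⊗ f : B_{p+2} → B_{p+1}`, for `f : B_{p+1} → B_p`. -/
noncomputable def mapTail (ε : A →ₐ[k] k) {p : ℕ} (f : bar ε (p + 1) →ₗ[k] bar ε p) :
    bar ε (p + 2) →ₗ[k] bar ε (p + 1) :=
  (f.lTensor (augIdeal ε) : augIdeal ε ⊗[k] bar ε (p + 1) →ₗ[k] augIdeal ε ⊗[k] bar ε p)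

/-- The differential `B_{p+1} → B_p` of the bar construction. It is zero for `p = 0`, and
`d (a ⊗ (b ⊗ x)) = ab ⊗ x - a ⊗ d (b ⊗ x)` for `p ≥ 1`; in other words
`d [a₁ | ⋯ | aₚ] = ∑ i, (-1)^(i-1) [a₁ | ⋯ | aᵢ aᵢ₊₁ | ⋯ | aₚ]`. -/
noncomputable def barD (ε : A →ₐ[k] k) : (p : ℕ) → bar ε (p + 1) →ₗ[k] bar ε p
  | 0 => 0
  | p + 1 => mulHead ε p - mapTail ε (barD ε p)

/-- The cycles of the bar construction in degree `p` (the differential out of `B_0` is zero). -/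
noncomputable def barCycles (ε : A →ₐ[k] k) : (p : ℕ) → Submodule k (bar ε p)
  | 0 => ⊤
  | p + 1 => LinearMap.ker (barD ε p)

/-- The component `B_p^{(j)}` of weight `j`, where `W i` is the component of weight `i` of `A`:
it is spanned by the `[a₁ | ⋯ | aₚ]` with homogeneous `aᵢ` whose weights add up to `j`. -/
noncomputable def barWeight (ε : A →ₐ[k] k) (W : ℕ → Submodule k A) :
    (p : ℕ) → ℕ → Submodule k (bar ε p)
  | 0, 0 => ⊤
  | 0, _ + 1 => ⊥
  | p + 1, j => Submodule.span k
      {t | ∃ i l : ℕ, i + l = j ∧ ∃ a : augIdeal ε, (a : A) ∈ W i ∧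
        ∃ x ∈ barWeight ε W p l, t = cons ε a x}

theorem barD_cons_cons (ε : A →ₐ[k] k) {p : ℕ} (a b : augIdeal ε) (x : bar ε p) :
    barD ε (p + 1) (cons ε a (cons ε b x)) =
      cons ε (augMul ε (a ⊗ₜ[k] b)) x - cons ε a (barD ε p (cons ε b x)) :=
  rfl

theorem bar_induction (ε : A →ₐ[k] k) {p : ℕ} {P : bar ε (p + 1) → Prop} (h0 : P 0)
    (hadd : ∀ y z, P y → P z → P (y + z)) (hcons : ∀ a x, P (cons ε a x)) (z) : P z :=
  TensorProduct.induction_on (R := k) (M := augIdeal ε) (N := bar ε p) (motive := P) z h0 hcons hadd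

theorem augMul_assoc (ε : A →ₐ[k] k) (a b c : augIdeal ε) :
    augMul ε (augMul ε (a ⊗ₜ[k] b) ⊗ₜ[k] c) = augMul ε (a ⊗ₜ[k] augMul ε (b ⊗ₜ[k] c)) :=
  Subtype.ext (mul_assoc (a : A) b c)

theorem cons_add (ε : A →ₐ[k] k) {p : ℕ} (a : augIdeal ε) (x y : bar ε p) :
    cons ε a (x + y) = cons ε a x + cons ε a y :=
  TensorProduct.tmul_add a x y

theorem cons_sub (ε : A →ₐ[k] k) {p : ℕ} (a : augIdeal ε) (x y : bar ε p) :
    cons ε a (x - y) = cons ε a x - cons ε a y :=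
  TensorProduct.tmul_sub a x y

theorem cons_zero (ε : A →ₐ[k] k) {p : ℕ} (a : augIdeal ε) :
    cons ε a (0 : bar ε p) = 0 :=
  TensorProduct.tmul_zero _ a

/-- The bar construction is a complex. -/
theorem barD_barD (ε : A →ₐ[k] k) (p : ℕ) (z : bar ε (p + 2)) :
    barD ε p (barD ε (p + 1) z) = 0 := by
  induction p with
  | zero => rfl
  | succ p ih =>
    induction z using bar_induction with
    | h0 => simp
    | hadd y z hy hz => rw [map_add, map_add, hy, hz, add_zero]
    | hcons a y =>
      induction y using bar_induction with
      | h0 => simp [cons_zero]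
      | hadd y z hy hz => rw [cons_add, map_add, map_add, hy, hz, add_zero]
      | hcons b y =>
        induction y using bar_induction with
        | h0 => simp [cons_zero]
        | hadd y z hy hz => rw [cons_add, cons_add, map_add, map_add, hy, hz, add_zero]
        | hcons c x =>
          have h := ih (cons ε b (cons ε c x))
          rw [barD_cons_cons, map_sub] at h
          have h' := congrArg (cons ε a) h
          rw [cons_sub, cons_zero] at h'
          rw [barD_cons_cons ε a b (cons ε c x), map_sub, barD_cons_cons, barD_cons_cons ε b c x,
            cons_sub, map_sub, barD_cons_cons, barD_cons_cons, augMul_assoc, ← sub_eq_zero.mp h']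
          abel

end BarConstruction

/-! ### Quadratic algebras -/

namespace QuadAlg

variable {k : Type u} [Field k] {V : Type u} [AddCommGroup V] [Module k V]

/-- The multiplication map `V ⊗ V → T(V)`, identifying `V ⊗ V` with the tensors of degree two. -/
noncomputable def quadMap (k : Type u) [Field k] (V : Type u) [AddCommGroup V] [Module k V] :
    V ⊗[k] V →ₗ[k] TensorAlgebra k V :=
  TensorProduct.lift
    ((LinearMap.mul k (TensorAlgebra k V)).compl₁₂ (TensorAlgebra.ι k) (TensorAlgebra.ι k))

/-- The relation on `T(V)` that makes every element of `R ⊆ V ⊗ V` equal to zero. -/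
def Rel (R : Submodule k (V ⊗[k] V)) (a b : TensorAlgebra k V) : Prop :=
  (∃ r ∈ R, a = quadMap k V r) ∧ b = 0

/-- The quadratic algebra `A(V, R) = T(V) / (R)`. -/
abbrev Alg (R : Submodule k (V ⊗[k] V)) : Type u := RingQuot (Rel R)

/-- The canonical map from the space of generators to `A(V, R)`. -/
noncomputable def gen (R : Submodule k (V ⊗[k] V)) : V →ₗ[k] Alg R :=
  (RingQuot.mkAlgHom k (Rel R)).toLinearMap ∘ₗ TensorAlgebra.ι k

/-- The weight component `A_j`: the image of `V^{⊗ j}` in `A(V, R)`. -/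
noncomputable def weight (R : Submodule k (V ⊗[k] V)) (j : ℕ) : Submodule k (Alg R) :=
  (LinearMap.range (gen R)) ^ j

theorem algebraMapInv_quadMap (r : V ⊗[k] V) :
    (TensorAlgebra.algebraMapInv (quadMap k V r) : k) = 0 := by
  induction r with
  | zero => simp
  | tmul x y => simp [quadMap, TensorAlgebra.algebraMapInv]
  | add x y hx hy => rw [map_add, map_add, hx, hy, add_zero]

/-- The augmentation `A(V, R) → k`, which sends all generators to zero. -/
noncomputable def aug (R : Submodule k (V ⊗[k] V)) : Alg R →ₐ[k] k :=
  RingQuot.liftAlgHom k ⟨TensorAlgebra.algebraMapInv, by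
    rintro a b ⟨⟨r, -, rfl⟩, rfl⟩
    rw [algebraMapInv_quadMap, map_zero]⟩

/-- The quadratic algebra `A(V, R)` is Koszul: in each degree `p`, the homology of its bar
construction is concentrated in weight `p`, that is, `H_p(B)^{(j)} = 0` for all `j ≠ p`. -/
def IsKoszul (R : Submodule k (V ⊗[k] V)) : Prop :=
  ∀ p j : ℕ, j ≠ p →
    BarConstruction.barCycles (aug R) p ⊓ BarConstruction.barWeight (aug R) (weight R) p j ≤
      (BarConstruction.barWeight (aug R) (weight R) (p + 1) j).map
        (BarConstruction.barD (aug R) p)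

end QuadAlg

/-! ### The quadratic data of the algebras `A(DLie, n)` -/

namespace DLie

/-- The index set of the generators: pairs `i < j` in an `n`-element chain. -/
abbrev Idx (n : ℕ) : Type := {q : Fin n × Fin n // q.1 < q.2}

/-- The space of generators, with basis the `x_{ij}`, `i < j`. -/
abbrev Gen (k : Type u) [Field k] (n : ℕ) : Type u := Idx n →₀ k

/-- The generator `x_{ij}`, `i < j`. -/
noncomputable def x (k : Type u) [Field k] {n : ℕ} {i j : Fin n} (h : i < j) : Gen k n :=
  Finsupp.single ⟨(i, j), h⟩ 1

/-- The space of relations of `A(DLie, n)`, spanned by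
`x_{ij} x_{jk} - x_{jk} x_{ik} - x_{ik} x_{ij}` and
`x_{jk} x_{ij} - x_{ik} x_{jk} - x_{ij} x_{ik}` for `i < j < k`, and by
`x_{ab} x_{uv} - x_{uv} x_{ab}` for `{a, b} ∩ {u, v} = ∅`. -/
noncomputable def relations (k : Type u) [Field k] (n : ℕ) :
    Submodule k (Gen k n ⊗[k] Gen k n) :=
  Submodule.span k
    ({r | ∃ (i j l : Fin n) (hij : i < j) (hjl : j < l),
        r = x k hij ⊗ₜ[k] x k hjl - x k hjl ⊗ₜ[k] x k (hij.trans hjl)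
          - x k (hij.trans hjl) ⊗ₜ[k] x k hij} ∪
     {r | ∃ (i j l : Fin n) (hij : i < j) (hjl : j < l),
        r = x k hjl ⊗ₜ[k] x k hij - x k (hij.trans hjl) ⊗ₜ[k] x k hjl
          - x k hij ⊗ₜ[k] x k (hij.trans hjl)} ∪
     {r | ∃ (a b u v : Fin n) (hab : a < b) (huv : u < v),
        Disjoint ({a, b} : Finset (Fin n)) {u, v} ∧
        r = x k hab ⊗ₜ[k] x k huv - x k huv ⊗ₜ[k] x k hab})

end DLie

/-! Write `B` for the bar construction and `I_m` for the ideal generated by the `x_{ij}` with `j ≥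
m` (indices counted from 0), the kernel of the endomorphism `trunc k n m`. These ideals form a chain
from `I_n = 0` up to `I_0 = Ā`. The proof is a Koszul filtration argument along this chain: each
`I_m ⊗ B` has its degree `p` homology in weight `p + 1` only, and for `m = 0` this is Koszulness,
because `Ā ⊗ B` is the bar construction shifted by one.

The inductive step (`isDiagonal_ker`) rests on the fact that, as a right module, `I_m / I_{m+1}` is
a direct sum of copies of `A / I_{m+1}`, one for each `x_{sm}` with `s < m`, shifted by one in
weight. Since `A ⊗ B` is acyclic apart from degree and weight 0, the homology of `(A / I_{m+1}) ⊗ B`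
in degree `p` is that of `I_{m+1} ⊗ B` in degree `p - 1`. Hence diagonality of `I_{m+1}` in degrees
`p` and `p - 1` passes to the extension `I_m` in degree `p`.

That the `x_{sm}` generate `I_m` modulo `I_{m+1}` as a right ideal follows by using the relations to
move them to the left (`mul_mem_topIdeal`). Their independence over `A / I_{m+1}` is the main point.
It comes from a representation of the algebra on words in the letters `s` with a final entry in `A`:
`x_{sm}` prepends `s`, and `x_{ij}` with `j < m` acts by a derivation twisted by the transposition
`(i j)`. That these operators satisfy the relations is `isRep_skewOp` and `isHalfRep_levelOp`.
Reading off a first letter then gives the coefficient maps `coeffAt`. -/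

namespace BarConstruction

/-! ### The complex `A ⊗ B` and its contraction -/

variable {k : Type u} [Field k] {A : Type u} [Ring A] [Algebra k A]

/-- The multiplication `A ⊗ Ā → A`. -/
noncomputable def coeffMul (ε : A →ₐ[k] k) : A ⊗[k] augIdeal ε →ₗ[k] A :=
  TensorProduct.lift ((LinearMap.mul k A).compl₂ (augIdeal ε).subtype)

/-- The differential of the bar construction with coefficients in the right module `A`:
`D (a ⊗ [b | x]) = ab ⊗ x - a ⊗ d [b | x]`. -/
noncomputable def coeffD (ε : A →ₐ[k] k) (p : ℕ) :
    A ⊗[k] bar ε (p + 1) →ₗ[k] A ⊗[k] bar ε p :=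
  (show A ⊗[k] bar ε (p + 1) →ₗ[k] A ⊗[k] bar ε p from (coeffMul ε).rTensor (bar ε p) ∘ₗ
    (TensorProduct.assoc k A (augIdeal ε) (bar ε p)).symm.toLinearMap) - (barD ε p).lTensor A

theorem coeffD_tmul_cons (ε : A →ₐ[k] k) {p : ℕ} (a : A) (b : augIdeal ε) (x : bar ε p) :
    coeffD ε p (a ⊗ₜ cons ε b x) = (a * b) ⊗ₜ x - a ⊗ₜ barD ε p (cons ε b x) :=
  rfl

theorem coeff_induction (ε : A →ₐ[k] k) {p : ℕ} {P : A ⊗[k] bar ε (p + 1) → Prop} (h0 : P 0)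
    (hadd : ∀ y z, P y → P z → P (y + z)) (hcons : ∀ a b x, P (a ⊗ₜ cons ε b x)) (z) : P z := by
  induction z with
  | zero => exact h0
  | add y z hy hz => exact hadd y z hy hz
  | tmul a y =>
    induction y using bar_induction with
    | h0 => rw [TensorProduct.tmul_zero]; exact h0
    | hadd y z hy hz => rw [TensorProduct.tmul_add]; exact hadd _ _ hy hz
    | hcons b x => exact hcons a b x

/-- A linear endomorphism of the coefficients. -/
noncomputable abbrev coeffMap (ε : A →ₐ[k] k) (p : ℕ) (f : A →ₗ[k] A) :
    A ⊗[k] bar ε p →ₗ[k] A ⊗[k] bar ε p :=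
  f.rTensor (bar ε p)

theorem coeffD_coeffMap_mulLeft (ε : A →ₐ[k] k) (p : ℕ) (c : A) (z : A ⊗[k] bar ε (p + 1)) :
    coeffD ε p (coeffMap ε (p + 1) (LinearMap.mulLeft k c) z) =
      coeffMap ε p (LinearMap.mulLeft k c) (coeffD ε p z) := by
  induction z using coeff_induction with
  | h0 => simp
  | hadd y z hy hz => rw [map_add, map_add, hy, hz, map_add, map_add]
  | hcons a b x =>
    rw [LinearMap.rTensor_tmul, coeffD_tmul_cons, coeffD_tmul_cons, map_sub,
      LinearMap.rTensor_tmul, LinearMap.rTensor_tmul]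
    simp [mul_assoc]

theorem coeffD_coeffD (ε : A →ₐ[k] k) (p : ℕ) (z : A ⊗[k] bar ε (p + 2)) :
    coeffD ε p (coeffD ε (p + 1) z) = 0 := by
  induction z using coeff_induction with
  | h0 => simp
  | hadd y z hy hz => rw [map_add, map_add, hy, hz, add_zero]
  | hcons a b x =>
    induction x using bar_induction with
    | h0 => simp [cons_zero]
    | hadd y z hy hz =>
      rw [cons_add, TensorProduct.tmul_add, map_add, map_add, hy, hz, add_zero]
    | hcons c x =>
      have h := barD_barD ε p (cons ε b (cons ε c x))
      rw [barD_cons_cons, map_sub, sub_eq_zero] at h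
      rw [coeffD_tmul_cons, barD_cons_cons, TensorProduct.tmul_sub, map_sub, map_sub,
        coeffD_tmul_cons, coeffD_tmul_cons, h,
        coeffD_tmul_cons, mul_assoc]
      change _ - _ - ((a * (b * c : A)) ⊗ₜ x - _ - _) = (0 : A ⊗[k] bar ε p)
      abel

/-- The projection `A → Ā` along the unit. -/
noncomputable def augProj (ε : A →ₐ[k] k) : A →ₗ[k] augIdeal ε :=
  LinearMap.codRestrict (augIdeal ε) (LinearMap.id - Algebra.linearMap k A ∘ₗ ε.toLinearMap)
    (fun a => by simp)

theorem coe_augProj (ε : A →ₐ[k] k) (a : A) :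
    (augProj ε a : A) = a - algebraMap k A (ε a) := rfl

/-- The contraction `a ⊗ x ↦ 1 ⊗ [a - ε a | x]`. -/
noncomputable def contraction (ε : A →ₐ[k] k) (p : ℕ) :
    A ⊗[k] bar ε p →ₗ[k] A ⊗[k] bar ε (p + 1) :=
  (TensorProduct.mk k A (augIdeal ε ⊗[k] bar ε p) 1) ∘ₗ (augProj ε).rTensor (bar ε p)

theorem contraction_tmul (ε : A →ₐ[k] k) {p : ℕ} (a : A) (x : bar ε p) :
    contraction ε p (a ⊗ₜ x) = 1 ⊗ₜ cons ε (augProj ε a) x := rfl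

/-- The contraction is a homotopy between the identity and zero in positive degrees. -/
theorem coeffD_contraction (ε : A →ₐ[k] k) (p : ℕ) (z : A ⊗[k] bar ε (p + 1)) :
    coeffD ε (p + 1) (contraction ε (p + 1) z) + contraction ε p (coeffD ε p z) = z := by
  induction z using coeff_induction with
  | h0 => simp
  | hadd y z hy hz => 
    simp only [map_add]
    rw [add_add_add_comm, hy, hz]
  | hcons a b x =>
    have hb : ε (b : A) = 0 := b.2
    -- As `b` lies in `Ā`, so does `ab`; splitting off `ε a` from `a` produces the product inside
    -- the bar and a term that cancels against the unit part of `a`.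
    have h1 : augProj ε (a * b) = augMul ε (augProj ε a ⊗ₜ[k] b) + ε a • b := by
      apply Subtype.ext
      change a * b - algebraMap k A (ε (a * b)) = (a - algebraMap k A (ε a)) * b + ε a • (b : A)
      rw [map_mul, hb, Algebra.smul_def]
      simp [sub_mul]
    have h2 : ∀ (b c : augIdeal ε) (x : bar ε p), cons ε (b + c) x = cons ε b x + cons ε c x :=
      fun b c x => TensorProduct.add_tmul b c x
    have h3 : ∀ (r : k) (b : augIdeal ε) (x : bar ε p), cons ε (r • b) x = r • cons ε b x :=
      fun r b x => rfl
    rw [contraction_tmul, coeffD_tmul_cons, coeffD_tmul_cons, map_sub, contraction_tmul,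
      contraction_tmul, barD_cons_cons, h1, h2, h3, coe_augProj, one_mul, TensorProduct.sub_tmul,
      TensorProduct.tmul_sub, TensorProduct.tmul_add, Algebra.algebraMap_eq_smul_one,
      TensorProduct.smul_tmul]
    abel

theorem coeffD_contraction_zero (ε : A →ₐ[k] k) {a : A} (ha : ε a = 0) (x : bar ε 0) :
    coeffD ε 0 (contraction ε 0 (a ⊗ₜ x)) = a ⊗ₜ x := by
  rw [contraction_tmul, coeffD_tmul_cons, coe_augProj, ha]
  simp [barD]

/-! ### Weights in `A ⊗ B` -/

section Weights

variable (ε : A →ₐ[k] k) (W : ℕ → Submodule k A)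

/-- The part of weight `j` of `N ⊗ B_p`, for a subspace `N` of `A`, as a subspace of
`A ⊗ B_p`. -/
noncomputable def coeffWeight (N : Submodule k A) (p j : ℕ) : Submodule k (A ⊗[k] bar ε p) :=
  Submodule.span k {t | ∃ i l : ℕ, i + l = j ∧ ∃ a ∈ N, a ∈ W i ∧
    ∃ x ∈ barWeight ε W p l, t = a ⊗ₜ x}

variable {ε W}

theorem tmul_mem_coeffWeight {N : Submodule k A} {p i l j : ℕ} (h : i + l = j) {a : A}
    (haN : a ∈ N) (ha : a ∈ W i) {x : bar ε p} (hx : x ∈ barWeight ε W p l) :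
    a ⊗ₜ x ∈ coeffWeight ε W N p j :=
  Submodule.subset_span ⟨i, l, h, a, haN, ha, x, hx, rfl⟩

theorem coeffWeight_le {N : Submodule k A} {p j : ℕ} {S : Submodule k (A ⊗[k] bar ε p)}
    (h : ∀ i l, i + l = j → ∀ a ∈ N, a ∈ W i → ∀ x ∈ barWeight ε W p l, a ⊗ₜ x ∈ S) :
    coeffWeight ε W N p j ≤ S := by
  refine Submodule.span_le.2 ?_
  rintro _ ⟨i, l, hil, a, haN, ha, x, hx, rfl⟩
  exact h i l hil a haN ha x hx

theorem coeffWeight_mono {N N' : Submodule k A} (h : N ≤ N') (p j : ℕ) :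
    coeffWeight ε W N p j ≤ coeffWeight ε W N' p j :=
  coeffWeight_le fun _ _ hil _ haN ha _ hx => tmul_mem_coeffWeight hil (h haN) ha hx

theorem cons_mem_barWeight {p i l j : ℕ} (h : i + l = j) {a : augIdeal ε} (ha : (a : A) ∈ W i)
    {x : bar ε p} (hx : x ∈ barWeight ε W p l) : cons ε a x ∈ barWeight ε W (p + 1) j := by
  rw [barWeight]
  exact Submodule.subset_span ⟨i, l, h, a, ha, x, hx, rfl⟩

theorem barWeight_succ_le {p j : ℕ} {S : Submodule k (bar ε (p + 1))}
    (h : ∀ i l, i + l = j → ∀ a : augIdeal ε, (a : A) ∈ W i → ∀ x ∈ barWeight ε W p l,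
      cons ε a x ∈ S) : barWeight ε W (p + 1) j ≤ S := by
  rw [barWeight]
  refine Submodule.span_le.2 ?_
  rintro _ ⟨i, l, hil, a, ha, x, hx, rfl⟩
  exact h i l hil a ha x hx

theorem barD_mem_barWeight (hW : ∀ i j a b, a ∈ W i → b ∈ W j → a * b ∈ W (i + j)) {p j : ℕ} :
    ∀ z ∈ barWeight ε W (p + 1) j, barD ε p z ∈ barWeight ε W p j := by
  induction p generalizing j with
  | zero => intro z _; exact Submodule.zero_mem _
  | succ p ih =>
    refine barWeight_succ_le (S := (barWeight ε W (p + 1) j).comap (barD ε (p + 1))) ?_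
    intro i l hil a ha x hx
    refine barWeight_succ_le (S := (barWeight ε W (p + 1) j).comap
      (barD ε (p + 1) ∘ₗ TensorProduct.mk k (augIdeal ε) (bar ε (p + 1)) a)) ?_ hx
    intro i' l' hil' b hb y hy
    change barD ε (p + 1) (cons ε a (cons ε b y)) ∈ barWeight ε W (p + 1) j
    rw [barD_cons_cons]
    refine Submodule.sub_mem _ ?_ ?_
    · exact cons_mem_barWeight (i := i + i') (l := l') (by omega) (hW _ _ _ _ ha hb) hy
    · exact cons_mem_barWeight hil ha (ih _ (cons_mem_barWeight hil' hb hy))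

theorem coeffD_mem_coeffWeight (hW : ∀ i j a b, a ∈ W i → b ∈ W j → a * b ∈ W (i + j))
    {N : Submodule k A} (hN : ∀ a ∈ N, ∀ b, a * b ∈ N) {p j : ℕ} :
    ∀ z ∈ coeffWeight ε W N (p + 1) j, coeffD ε p z ∈ coeffWeight ε W N p j := by
  refine coeffWeight_le (S := (coeffWeight ε W N p j).comap (coeffD ε p)) ?_
  intro i l hil a haN ha x hx
  refine barWeight_succ_le (S := (coeffWeight ε W N p j).comap
      (coeffD ε p ∘ₗ TensorProduct.mk k A (bar ε (p + 1)) a)) ?_ hx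
  intro i' l' hil' b hb y hy
  change coeffD ε p (a ⊗ₜ cons ε b y) ∈ coeffWeight ε W N p j
  rw [coeffD_tmul_cons]
  refine Submodule.sub_mem _ ?_ ?_
  · exact tmul_mem_coeffWeight (i := i + i') (l := l') (by omega) (hN a haN b)
      (hW _ _ _ _ ha hb) hy
  · exact tmul_mem_coeffWeight hil haN ha
      (barD_mem_barWeight hW _ (cons_mem_barWeight hil' hb hy))

theorem coeffMap_mem_coeffWeight {N N' : Submodule k A} (f : A →ₗ[k] A) (c : ℕ)
    (hf : ∀ i, ∀ a ∈ N, a ∈ W i → f a ∈ N' ∧ f a ∈ W (i + c)) {p j : ℕ} :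
    ∀ z ∈ coeffWeight ε W N p j, coeffMap ε p f z ∈ coeffWeight ε W N' p (j + c) := by
  refine coeffWeight_le (S := (coeffWeight ε W N' p (j + c)).comap (coeffMap ε p f)) ?_
  intro i l hil a haN ha x hx
  rw [Submodule.mem_comap, LinearMap.rTensor_tmul]
  exact tmul_mem_coeffWeight (by omega) (hf i a haN ha).1 (hf i a haN ha).2 hx

theorem contraction_mem_coeffWeight (h1 : (1 : A) ∈ W 0)
    (hε : ∀ i, ∀ a ∈ W i, a - algebraMap k A (ε a) ∈ W i) {p j : ℕ} :
    ∀ z ∈ coeffWeight ε W ⊤ p j, contraction ε p z ∈ coeffWeight ε W ⊤ (p + 1) j := by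
  refine coeffWeight_le (S := (coeffWeight ε W ⊤ (p + 1) j).comap (contraction ε p)) ?_
  intro i l hil a _ ha x hx
  rw [Submodule.mem_comap, contraction_tmul]
  exact tmul_mem_coeffWeight (zero_add _) Submodule.mem_top h1
    (cons_mem_barWeight hil (hε i a ha) hx)

theorem coeffMap_coeffMap (f g : A →ₗ[k] A) {p : ℕ} (z : A ⊗[k] bar ε p) :
    coeffMap ε p f (coeffMap ε p g z) = coeffMap ε p (f ∘ₗ g) z := by
  rw [coeffMap, coeffMap, coeffMap, LinearMap.rTensor_comp, LinearMap.comp_apply]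

theorem coeffMap_eq_zero_of_mem_coeffWeight {N : Submodule k A} {f : A →ₗ[k] A}
    (hf : ∀ a ∈ N, f a = 0) {p j : ℕ} :
    ∀ z ∈ coeffWeight ε W N p j, coeffMap ε p f z = 0 := by
  refine coeffWeight_le (S := LinearMap.ker (coeffMap ε p f)) ?_
  intro i l _ a haN _ x _
  rw [LinearMap.mem_ker, LinearMap.rTensor_tmul, hf a haN, TensorProduct.zero_tmul]

/-- An element of `A ⊗ B_p` that is killed by an idempotent endomorphism `f` of `A` preserving
weights lies in `ker f ⊗ B_p`. -/
theorem mem_coeffWeight_ker {f : A →ₗ[k] A} (hf : ∀ i, ∀ a ∈ W i, f a ∈ W i)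
    (hff : ∀ a, f (f a) = f a) {p j : ℕ} {z : A ⊗[k] bar ε p} (hz : z ∈ coeffWeight ε W ⊤ p j)
    (h0 : coeffMap ε p f z = 0) : z ∈ coeffWeight ε W (LinearMap.ker f) p j := by
  -- The projection `id - f` maps `A` into `ker f` and fixes `z`, because `f` kills `z`.
  have h := coeffMap_mem_coeffWeight (N := ⊤) (N' := LinearMap.ker f) (LinearMap.id - f) 0
    (fun i a _ ha => ⟨by simp [hff], Submodule.sub_mem _ ha (hf i a ha)⟩) z hz
  rwa [coeffMap, LinearMap.rTensor_sub, LinearMap.sub_apply, h0, sub_zero,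
    LinearMap.rTensor_id, LinearMap.id_apply] at h

/-- Acyclicity of `A ⊗ B`, by the contraction. In degree 0 the contraction only recovers elements of
`Ā ⊗ k`, hence the exclusion of weight 0 there. -/
theorem exists_coeffD_eq (h1 : (1 : A) ∈ W 0)
    (hε : ∀ i, ∀ a ∈ W i, a - algebraMap k A (ε a) ∈ W i)
    (hε0 : ∀ i, ∀ a ∈ W (i + 1), ε a = 0) {p j : ℕ} (hpj : p ≠ 0 ∨ j ≠ 0)
    {z : A ⊗[k] bar ε p} (hz : z ∈ coeffWeight ε W ⊤ p j)
    (hD : ∀ q (h : p = q + 1), coeffD ε q (h ▸ z) = 0) :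
    ∃ v ∈ coeffWeight ε W ⊤ (p + 1) j, coeffD ε p v = z := by
  refine ⟨contraction ε p z, contraction_mem_coeffWeight h1 hε z hz, ?_⟩
  cases p with
  | succ p =>
    have h := coeffD_contraction ε p z
    rwa [hD p rfl, map_zero, add_zero] at h
  | zero =>
    refine coeffWeight_le (S := LinearMap.eqLocus (coeffD ε 0 ∘ₗ contraction ε 0) LinearMap.id)
      ?_ hz
    intro i l hil a _ ha x hx
    cases l with
    | succ l =>
      have hx0 : x = 0 := hx
      rw [hx0, TensorProduct.tmul_zero]
      exact Submodule.zero_mem _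
    | zero =>
      cases i with
      | zero => omega
      | succ i => exact coeffD_contraction_zero ε (hε0 i a ha) x

/-! ### Diagonal homology and its passage to extensions -/

variable (ε W) in
/-- The complex `N ⊗ B` has homology only on the diagonal in degree `p`, that is, in
weight `p + 1`. -/
def IsDiagonal (N : Submodule k A) (p : ℕ) : Prop :=
  ∀ j, j ≠ p + 1 → ∀ z ∈ coeffWeight ε W N p j,
    (∀ q (h : p = q + 1), coeffD ε q (h ▸ z) = 0) →
    ∃ v ∈ coeffWeight ε W N (p + 1) j, coeffD ε p v = z

theorem isDiagonal_bot (p : ℕ) : IsDiagonal ε W ⊥ p := by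
  intro j _ z hz _
  refine ⟨0, Submodule.zero_mem _, ?_⟩
  have h := coeffMap_eq_zero_of_mem_coeffWeight (f := LinearMap.id) (N := ⊥)
    (fun a ha => ha) z hz
  rw [coeffMap, LinearMap.rTensor_id, LinearMap.id_apply] at h
  rw [map_zero, h]

/-- If `ker f = ker g + ∑ xᵢ A`, where the `xᵢ` are of weight one and right independent
modulo the right ideal `ker g`, then `ker f ⊗ B` inherits diagonal homology from
`ker g ⊗ B`. -/
theorem isDiagonal_ker (hW : ∀ i j a b, a ∈ W i → b ∈ W j → a * b ∈ W (i + j))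
    (h1 : (1 : A) ∈ W 0) (hε : ∀ i, ∀ a ∈ W i, a - algebraMap k A (ε a) ∈ W i)
    (hε0 : ∀ i, ∀ a ∈ W (i + 1), ε a = 0) {f g : A →ₐ[k] A}
    (hg : ∀ i, ∀ a ∈ W i, g a ∈ W i) (hgg : ∀ a, g (g a) = g a)
    (hfg : ∀ a, g a = 0 → f a = 0)
    {ι : Type*} [Fintype ι] [DecidableEq ι] (x : ι → A) (hx : ∀ i, x i ∈ W 1)
    (hfx : ∀ i, f (x i) = 0)
    (hf0 : ∀ a ∈ W 0, f a = 0 → g a = 0)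
    (hf1 : ∀ i, ∀ a ∈ W (i + 1), f a = 0 → ∃ b ∈ W (i + 1), g b = 0 ∧
      ∃ w : ι → A, (∀ s, w s ∈ W i) ∧ a = b + ∑ s, x s * w s)
    (δ : ι → A →ₗ[k] A) (hδ : ∀ s t a, δ s (x t * a) = if s = t then g a else 0)
    (hδg : ∀ s a, g a = 0 → δ s a = 0) {p : ℕ}
    (hp : IsDiagonal ε W (LinearMap.ker g.toLinearMap) p)
    (hp' : ∀ q, p = q + 1 → IsDiagonal ε W (LinearMap.ker g.toLinearMap) q) :
    IsDiagonal ε W (LinearMap.ker f.toLinearMap) p := by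
  have hmono : LinearMap.ker g.toLinearMap ≤ LinearMap.ker f.toLinearMap := fun a ha => hfg a ha
  intro j hj z hz hzD
  cases j with
  | zero =>
    -- In weight 0 no term `x s * w s` can occur, so `z` already lies over `ker g`.
    have hz' : z ∈ coeffWeight ε W (LinearMap.ker g.toLinearMap) p 0 := by
      refine coeffWeight_le ?_ hz
      intro i l hil a haf ha y hy
      obtain rfl : i = 0 := by omega
      exact tmul_mem_coeffWeight hil (hf0 a ha haf) ha hy
    obtain ⟨v, hv, rfl⟩ := hp 0 hj z hz' hzD
    exact ⟨v, coeffWeight_mono hmono _ _ hv, rfl⟩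
  | succ j =>
    have hdec : ∀ z ∈ coeffWeight ε W (LinearMap.ker f.toLinearMap) p (j + 1),
        ∃ b ∈ coeffWeight ε W (LinearMap.ker g.toLinearMap) p (j + 1),
        ∃ w : ι → A ⊗[k] bar ε p, (∀ s, w s ∈ coeffWeight ε W ⊤ p j) ∧
          z = b + ∑ s, coeffMap ε p (LinearMap.mulLeft k (x s)) (w s) := by
      intro z hz
      unfold coeffWeight at hz
      induction hz using Submodule.span_induction with
      | zero => exact ⟨0, Submodule.zero_mem _, 0, fun _ => Submodule.zero_mem _, by simp⟩
      | smul c z _ ih =>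
        obtain ⟨b, hb, w, hw, rfl⟩ := ih
        exact ⟨c • b, Submodule.smul_mem _ _ hb, fun s => c • w s,
          fun s => Submodule.smul_mem _ _ (hw s), by simp [Finset.smul_sum]⟩
      | add y z _ _ ihy ihz =>
        obtain ⟨b, hb, w, hw, rfl⟩ := ihy
        obtain ⟨b', hb', w', hw', rfl⟩ := ihz
        exact ⟨b + b', Submodule.add_mem _ hb hb', fun s => w s + w' s,
          fun s => Submodule.add_mem _ (hw s) (hw' s), by
            simp only [map_add, Finset.sum_add_distrib]; abel⟩
      | mem z hz =>
        obtain ⟨i, l, hil, a, haf, ha, y, hy, rfl⟩ := hz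
        cases i with
        | zero =>
          exact ⟨a ⊗ₜ y, tmul_mem_coeffWeight hil (hf0 a ha haf) ha hy, 0,
            fun _ => Submodule.zero_mem _, by simp⟩
        | succ i =>
          obtain ⟨b, hb, hgb, w, hw, rfl⟩ := hf1 i a ha haf
          refine ⟨b ⊗ₜ y, tmul_mem_coeffWeight hil hgb hb hy, fun s => w s ⊗ₜ y, fun s =>
            tmul_mem_coeffWeight (i := i) (l := l) (by omega) Submodule.mem_top (hw s) hy, ?_⟩
          rw [TensorProduct.add_tmul, TensorProduct.sum_tmul]
          rfl
    obtain ⟨b, hb, w, hw, rfl⟩ := hdec z hz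
    -- Each `w s` is a cycle modulo `ker g`; it has to be shown to be a boundary modulo `ker g`.
    have hwu : ∀ s, ∃ v ∈ coeffWeight ε W ⊤ (p + 1) j,
        w s - coeffD ε p v ∈ coeffWeight ε W (LinearMap.ker g.toLinearMap) p j := by
      intro s
      cases p with
      | zero =>
        obtain ⟨v, hv, hvw⟩ := exists_coeffD_eq h1 hε hε0 (Or.inr (by omega)) (hw s)
          (fun q h => by omega)
        exact ⟨v, hv, by rw [hvw, sub_self]; exact Submodule.zero_mem _⟩
      | succ q =>
        have hDb : coeffMap ε q (δ s) (coeffD ε q b) = 0 :=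
          coeffMap_eq_zero_of_mem_coeffWeight (fun a ha => hδg s a ha) _
            (coeffD_mem_coeffWeight hW (fun a ha c => by
              have : g a = 0 := ha
              simp [this]) b hb)
        have hcomp : ∀ t, δ s ∘ₗ LinearMap.mulLeft k (x t) =
            if s = t then g.toLinearMap else 0 := by
          intro t
          ext a
          split_ifs with h <;> simp [hδ, h]
        -- Left multiplication by `x t` commutes with the differential, so applying `δ s` to the
        -- cycle condition isolates `g` of the boundary of `w s`.
        have hgD : coeffMap ε q g.toLinearMap (coeffD ε q (w s)) = 0 := by
          have h := congrArg (coeffMap ε q (δ s)) (hzD q rfl)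
          dsimp only at h
          rw [map_add, map_add, hDb, zero_add, map_zero, map_sum, map_sum,
            Finset.sum_eq_single s] at h
          · rwa [coeffD_coeffMap_mulLeft, coeffMap_coeffMap, hcomp, if_pos rfl] at h
          · intro t _ hts
            rw [coeffD_coeffMap_mulLeft, coeffMap_coeffMap, hcomp, if_neg hts.symm, coeffMap,
              LinearMap.rTensor_zero, LinearMap.zero_apply]
          · intro h
            exact absurd (Finset.mem_univ s) h
        -- The connecting map: the boundary of `w s` is a cycle over `ker g` in degree `p - 1` and
        -- weight `j`, which is off the diagonal. Correcting `w s` by `u` makes it a genuine cycle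
        -- in the acyclic complex `A ⊗ B`.
        obtain ⟨u, hu, huD⟩ := hp' q rfl j (by omega) (coeffD ε q (w s))
          (mem_coeffWeight_ker hg hgg (coeffD_mem_coeffWeight hW (fun _ _ _ => Submodule.mem_top)
            _ (hw s)) hgD) (by
            rintro r rfl
            exact coeffD_coeffD ε r (w s))
        obtain ⟨v, hv, hvD⟩ := exists_coeffD_eq h1 hε hε0 (Or.inl q.succ_ne_zero)
          (Submodule.sub_mem _ (hw s)
            (coeffWeight_mono (N' := ⊤) (fun _ _ => Submodule.mem_top) _ _ hu)) (by
            intro r hr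
            obtain rfl : q = r := by omega
            dsimp only
            rw [map_sub, huD, sub_self])
        exact ⟨v, hv, by rw [hvD, sub_sub_cancel]; exact hu⟩
    choose v hv hwv using hwu
    have hxv : ∀ s, coeffMap ε (p + 1) (LinearMap.mulLeft k (x s)) (v s) ∈
        coeffWeight ε W (LinearMap.ker f.toLinearMap) (p + 1) (j + 1) := fun s =>
      coeffMap_mem_coeffWeight _ 1 (fun i a _ ha => ⟨by simp [hfx], by
        rw [add_comm]; exact hW _ _ _ _ (hx s) ha⟩) _ (hv s)
    have hxw : ∀ s, coeffMap ε p (LinearMap.mulLeft k (x s)) (w s - coeffD ε p (v s)) ∈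
        coeffWeight ε W (LinearMap.ker g.toLinearMap) p (j + 1) := fun s =>
      coeffMap_mem_coeffWeight _ 1 (fun i a hga ha => ⟨by
        have : g a = 0 := hga
        simp [this], by rw [add_comm]; exact hW _ _ _ _ (hx s) ha⟩) _ (hwv s)
    -- Up to a boundary over `ker f`, `z` is now a cycle over `ker g`, to which `hp` applies.
    have hsub : b + ∑ s, coeffMap ε p (LinearMap.mulLeft k (x s)) (w s) =
        (b + ∑ s, coeffMap ε p (LinearMap.mulLeft k (x s)) (w s - coeffD ε p (v s))) +
        coeffD ε p (∑ s, coeffMap ε (p + 1) (LinearMap.mulLeft k (x s)) (v s)) := by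
      rw [map_sum, add_assoc, ← Finset.sum_add_distrib]
      congr 1
      refine Finset.sum_congr rfl fun s _ => ?_
      rw [coeffD_coeffMap_mulLeft, map_sub, sub_add_cancel]
    rw [hsub] at hzD ⊢
    obtain ⟨u, hu, huD⟩ := hp (j + 1) hj
      (b + ∑ s, coeffMap ε p (LinearMap.mulLeft k (x s)) (w s - coeffD ε p (v s)))
      (Submodule.add_mem _ hb (Submodule.sum_mem _ fun s _ => hxw s)) (by
        rintro q rfl
        have h := hzD q rfl
        dsimp only at h ⊢
        rwa [map_add, coeffD_coeffD, add_zero] at h)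
    refine ⟨u + ∑ s, coeffMap ε (p + 1) (LinearMap.mulLeft k (x s)) (v s),
      Submodule.add_mem _ (coeffWeight_mono hmono _ _ hu) (Submodule.sum_mem _ fun s _ => hxv s),
      ?_⟩
    rw [map_add, huD]

/-! ### From `Ā ⊗ B` to the bar construction -/

variable (ε) in
/-- The inclusion of `B_{p+1} = Ā ⊗ B_p` in `A ⊗ B_p`. -/
noncomputable def barIncl (p : ℕ) : bar ε (p + 1) →ₗ[k] A ⊗[k] bar ε p :=
  ((augIdeal ε).subtype.rTensor (bar ε p) : augIdeal ε ⊗[k] bar ε p →ₗ[k] A ⊗[k] bar ε p)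

theorem barIncl_injective (p : ℕ) : Function.Injective (barIncl ε p) :=
  Module.Flat.rTensor_preserves_injective_linearMap _ (augIdeal ε).injective_subtype

theorem coeffD_barIncl (p : ℕ) (z : bar ε (p + 2)) :
    coeffD ε p (barIncl ε (p + 1) z) = barIncl ε p (barD ε (p + 1) z) := by
  induction z using bar_induction with
  | h0 => simp only [map_zero]
  | hadd y z hy hz => simp only [map_add, hy, hz]
  | hcons a x =>
    induction x using bar_induction with
    | h0 => simp only [cons_zero, map_zero]
    | hadd y z hy hz => simp only [cons_add, map_add, hy, hz]
    | hcons b x =>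
      rw [barD_cons_cons, map_sub]
      exact coeffD_tmul_cons ε (a : A) b x

theorem coeffWeight_ker_le (p j : ℕ) :
    coeffWeight ε W (augIdeal ε) p j ≤
      (barWeight ε W (p + 1) j).map (barIncl ε p) :=
  coeffWeight_le fun _ _ hil a haN ha x hx =>
    ⟨cons ε ⟨a, haN⟩ x, cons_mem_barWeight hil ha hx, rfl⟩

theorem barWeight_succ_le_comap (p j : ℕ) :
    barWeight ε W (p + 1) j ≤
      (coeffWeight ε W (augIdeal ε) p j).comap (barIncl ε p) :=
  barWeight_succ_le fun _ _ hil a ha _ hx => tmul_mem_coeffWeight hil a.2 ha hx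

/-- If the complex `Ā ⊗ B` has diagonal homology, so has the bar construction. -/
theorem barCycles_inf_barWeight_le (h : ∀ p, IsDiagonal ε W (augIdeal ε) p) {p j : ℕ}
    (hj : j ≠ p) : barCycles ε p ⊓ barWeight ε W p j ≤ (barWeight ε W (p + 1) j).map (barD ε p) := by
  rintro z ⟨hz, hzj⟩
  cases p with
  | zero =>
    cases j with
    | zero => exact absurd rfl hj
    | succ j =>
      have hz0 : z = 0 := hzj
      rw [hz0]
      exact Submodule.zero_mem _
  | succ p =>
    obtain ⟨v, hv, hvD⟩ := h p j hj (barIncl ε p z)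
      (barWeight_succ_le_comap p j hzj) (by
        rintro q rfl
        have hz' : barD ε (q + 1) z = 0 := hz
        dsimp only
        rw [coeffD_barIncl, hz', map_zero])
    obtain ⟨y, hy, rfl⟩ := coeffWeight_ker_le (p + 1) j hv
    refine ⟨y, hy, barIncl_injective p ?_⟩
    rw [← hvD, coeffD_barIncl]

end Weights

end BarConstruction

/-! ### Universal property and weights of a quadratic algebra -/

namespace QuadAlg

variable {k : Type u} [Field k] {V : Type u} [AddCommGroup V] [Module k V]
  {R : Submodule k (V ⊗[k] V)}

/-- The multiplication `V ⊗ V → B` induced by a linear map from `V` to an algebra `B`. -/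
noncomputable def quadLift {B : Type*} [Ring B] [Algebra k B] (f : V →ₗ[k] B) : V ⊗[k] V →ₗ[k] B :=
  TensorProduct.lift ((LinearMap.mul k B).compl₁₂ f f)

theorem quadLift_tmul {B : Type*} [Ring B] [Algebra k B] (f : V →ₗ[k] B) (v w : V) :
    quadLift f (v ⊗ₜ w) = f v * f w := rfl

theorem lift_quadMap {B : Type*} [Ring B] [Algebra k B] (f : V →ₗ[k] B) (r : V ⊗[k] V) :
    TensorAlgebra.lift k f (quadMap k V r) = quadLift f r := by
  induction r with
  | zero => simp
  | tmul v w => simp [quadMap, quadLift]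
  | add r s hr hs => rw [map_add, map_add, hr, hs, map_add]

/-- The universal property of `A(V, R)`. -/
noncomputable def lift {B : Type*} [Ring B] [Algebra k B] (f : V →ₗ[k] B)
    (hf : ∀ r ∈ R, quadLift f r = 0) : Alg R →ₐ[k] B :=
  RingQuot.liftAlgHom k ⟨TensorAlgebra.lift k f, by
    rintro a b ⟨⟨r, hr, rfl⟩, rfl⟩
    rw [lift_quadMap, hf r hr, map_zero]⟩

theorem lift_gen {B : Type*} [Ring B] [Algebra k B] (f : V →ₗ[k] B)
    (hf : ∀ r ∈ R, quadLift f r = 0) (v : V) : lift f hf (gen R v) = f v := by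
  simp [lift, gen]

theorem quadLift_gen (r : V ⊗[k] V) (hr : r ∈ R) : quadLift (gen R) r = 0 := by
  have h : quadLift (gen R) r = RingQuot.mkAlgHom k (Rel R) (quadMap k V r) := by
    clear hr
    induction r with
    | zero => simp
    | tmul v w => simp [quadMap, quadLift, gen]
    | add r s hr hs => rw [map_add, map_add, hr, hs, map_add]
  rw [h, RingQuot.mkAlgHom_rel k (show Rel R (quadMap k V r) 0 from ⟨⟨r, hr, rfl⟩, rfl⟩), map_zero]

theorem aug_gen (v : V) : aug R (gen R v) = 0 := by
  simp [aug, gen, TensorAlgebra.algebraMapInv]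

theorem algHom_ext {B : Type*} [Ring B] [Algebra k B] {f g : Alg R →ₐ[k] B}
    (h : ∀ v, f (gen R v) = g (gen R v)) : f = g := by
  apply RingQuot.ringQuot_ext'
  apply TensorAlgebra.hom_ext
  ext v
  exact h v

theorem weight_zero : weight R 0 = 1 := pow_zero _

theorem gen_mem_weight (v : V) : gen R v ∈ weight R 1 := by
  rw [weight, pow_one]
  exact LinearMap.mem_range_self _ v

theorem mul_mem_weight (i j : ℕ) (a b : Alg R) (ha : a ∈ weight R i) (hb : b ∈ weight R j) :
    a * b ∈ weight R (i + j) := by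
  rw [weight, pow_add]
  exact Submodule.mul_mem_mul ha hb

theorem weight_succ_le {i : ℕ} {S : Submodule k (Alg R)}
    (h : ∀ v, ∀ a ∈ weight R i, gen R v * a ∈ S) : weight R (i + 1) ≤ S := by
  rw [weight, pow_succ', Submodule.mul_le]
  rintro _ ⟨v, rfl⟩ a ha
  exact h v a ha

theorem aug_eq_zero_of_mem_weight (i : ℕ) (a : Alg R) (ha : a ∈ weight R (i + 1)) :
    aug R a = 0 := by
  refine weight_succ_le (S := LinearMap.ker (aug R).toLinearMap) ?_ ha
  intro v a _
  simp [aug_gen]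

theorem sub_aug_mem_weight (i : ℕ) (a : Alg R) (ha : a ∈ weight R i) :
    a - algebraMap k _ (aug R a) ∈ weight R i := by
  cases i with
  | zero =>
    rw [weight_zero, Submodule.mem_one] at ha ⊢
    obtain ⟨c, rfl⟩ := ha
    exact ⟨0, by simp⟩
  | succ i => rwa [aug_eq_zero_of_mem_weight i a ha, map_zero, sub_zero]

/-- An endomorphism that maps generators to generators preserves weights. -/
theorem map_mem_weight {f : Alg R →ₐ[k] Alg R} (hf : ∀ v, f (gen R v) ∈ weight R 1) (i : ℕ) :
    ∀ a ∈ weight R i, f a ∈ weight R i := by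
  induction i with
  | zero =>
    intro a ha
    rw [weight_zero, Submodule.mem_one] at ha ⊢
    obtain ⟨c, rfl⟩ := ha
    exact ⟨c, by simp⟩
  | succ i ih =>
    refine weight_succ_le (S := (weight R (i + 1)).comap f.toLinearMap) ?_
    intro v a ha
    change f (gen R v * a) ∈ weight R (i + 1)
    rw [map_mul, add_comm]
    exact mul_mem_weight _ _ _ _ (hf v) (ih a ha)

end QuadAlg

/-! ### Families satisfying the relations, and truncation -/

namespace DLie

open QuadAlg

variable {k : Type u} [Field k] {n : ℕ}

/-- The values on the generators. -/
noncomputable def genMap {B : Type*} [Ring B] [Algebra k B] (f : Fin n → Fin n → B) :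
    Gen k n →ₗ[k] B :=
  Finsupp.lsum k fun q : Idx n => LinearMap.toSpanSingleton k B (f q.1.1 q.1.2)

theorem genMap_x {B : Type*} [Ring B] [Algebra k B] (f : Fin n → Fin n → B) {i j : Fin n}
    (h : i < j) : genMap f (x k h) = f i j := by
  simp [genMap, x]

/-- The relations of `A(DLie, n)` for a family `f i j`, `i < j`. -/
structure IsHalfRep {B : Type*} [Ring B] (f : Fin n → Fin n → B) : Prop where
  left : ∀ i j l, i < j → j < l → f i j * f j l = f j l * f i l + f i l * f i j
  right : ∀ i j l, i < j → j < l → f j l * f i j = f i l * f j l + f i j * f i l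
  comm : ∀ a b u v, a < b → u < v → a ≠ u → a ≠ v → b ≠ u → b ≠ v → b ≤ v →
    f a b * f u v = f u v * f a b

theorem IsHalfRep.quadLift_eq_zero {B : Type*} [Ring B] [Algebra k B] {f : Fin n → Fin n → B}
    (hf : IsHalfRep f) (r) (hr : r ∈ relations k n) : quadLift (genMap (k := k) f) r = 0 := by
  rw [relations] at hr
  induction hr using Submodule.span_induction with
  | zero => exact map_zero _
  | smul c r _ h => rw [map_smul, h, smul_zero]
  | add r s _ _ hr hs => rw [map_add, hr, hs, add_zero]
  | mem r hr =>
    rcases hr with (⟨i, j, l, hij, hjl, rfl⟩ | ⟨i, j, l, hij, hjl, rfl⟩) |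
      ⟨a, b, u, v, hab, huv, hd, rfl⟩
    · simp only [map_sub, quadLift_tmul, genMap_x, hf.left i j l hij hjl]
      abel
    · simp only [map_sub, quadLift_tmul, genMap_x, hf.right i j l hij hjl]
      abel
    · simp only [map_sub, quadLift_tmul, genMap_x]
      simp only [Finset.disjoint_insert_left, Finset.disjoint_singleton_left, Finset.mem_insert,
        Finset.mem_singleton, not_or] at hd
      obtain ⟨⟨h1, h2⟩, h3, h4⟩ := hd
      rcases le_total b v with h | h
      · rw [hf.comm a b u v hab huv h1 h2 h3 h4 h, sub_self]
      · rw [hf.comm u v a b huv hab (Ne.symm h1) (Ne.symm h3) (Ne.symm h2) (Ne.symm h4) h, sub_self]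

/-- The relations of `A(DLie, n)` for a family with `y j i = - y i j`. -/
structure IsRep {B : Type*} [Ring B] (y : Fin n → Fin n → B) : Prop where
  swap : ∀ i j, y j i = -y i j
  diag : ∀ i, y i i = 0
  triple : ∀ i j l, i ≠ j → j ≠ l → i ≠ l → y i j * y j l + y j l * y l i + y l i * y i j = 0
  comm : ∀ a b u v, a ≠ u → a ≠ v → b ≠ u → b ≠ v → y a b * y u v = y u v * y a b

theorem IsRep.isHalfRep {B : Type*} [Ring B] {y : Fin n → Fin n → B} (hy : IsRep y) :
    IsHalfRep y where
  left i j l hij hjl := by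
    have h := hy.triple i j l hij.ne hjl.ne (hij.trans hjl).ne
    rw [hy.swap i l, mul_neg, neg_mul, add_assoc, ← neg_add, ← sub_eq_add_neg, sub_eq_zero] at h
    exact h
  right i j l hij hjl := by
    have h := hy.triple l j i hjl.ne' hij.ne' (hij.trans hjl).ne'
    rw [hy.swap j l, hy.swap i j, neg_mul_neg, neg_mul, mul_neg, add_assoc, ← neg_add,
      ← sub_eq_add_neg, sub_eq_zero] at h
    rw [h, add_comm]
  comm a b u v _ _ h1 h2 h3 h4 _ := hy.comm a b u v h1 h2 h3 h4

theorem IsRep.map {B C : Type*} [Ring B] [Ring C] {y : Fin n → Fin n → B} (hy : IsRep y)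
    (f : B →+* C) : IsRep fun i j => f (y i j) where
  swap i j := by rw [hy.swap, map_neg]
  diag i := by rw [hy.diag, map_zero]
  triple i j l h1 h2 h3 := by
    rw [← map_mul, ← map_mul, ← map_mul, ← map_add, ← map_add, hy.triple i j l h1 h2 h3, map_zero]
  comm a b u v h1 h2 h3 h4 := by rw [← map_mul, hy.comm a b u v h1 h2 h3 h4, map_mul]

/-- The extension of a family `f i j`, `i < j`, with `y j i = - y i j` and `y i i = 0`. -/
def antisymm {B : Type*} [Ring B] (f : Fin n → Fin n → B) (i j : Fin n) : B :=
  if i < j then f i j else if j < i then -f j i else 0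

theorem antisymm_of_lt {B : Type*} [Ring B] (f : Fin n → Fin n → B) {i j : Fin n} (h : i < j) :
    antisymm f i j = f i j := if_pos h

theorem antisymm_of_gt {B : Type*} [Ring B] (f : Fin n → Fin n → B) {i j : Fin n} (h : j < i) :
    antisymm f i j = -f j i := by rw [antisymm, if_neg h.not_gt, if_pos h]

theorem antisymm_self {B : Type*} [Ring B] (f : Fin n → Fin n → B) (i : Fin n) :
    antisymm f i i = 0 := by simp [antisymm]

/-- The triple relation is invariant under cyclic rotation, so the six orderings of three indices
fall into two classes, one given by `left` and the other by `right`. The symmetric form removes the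
order of the indices from later checks. -/
theorem IsHalfRep.antisymm {B : Type*} [Ring B] {f : Fin n → Fin n → B} (hf : IsHalfRep f) :
    IsRep (antisymm f) where
  swap i j := by
    rcases lt_trichotomy i j with h | rfl | h
    · rw [antisymm_of_lt f h, antisymm_of_gt f h]
    · rw [antisymm_self, neg_zero]
    · rw [antisymm_of_lt f h, antisymm_of_gt f h, neg_neg]
  diag := antisymm_self f
  triple i j l hij hjl hil := by
    have key : ∀ i j l : Fin n, i < j → j < l → DLie.antisymm f i j * DLie.antisymm f j l +
        DLie.antisymm f j l * DLie.antisymm f l i + DLie.antisymm f l i * DLie.antisymm f i j = 0 := by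
      intro i j l hij hjl
      rw [antisymm_of_lt f hij, antisymm_of_lt f hjl, antisymm_of_gt f (hij.trans hjl),
        hf.left i j l hij hjl]
      noncomm_ring
    have key' : ∀ i j l : Fin n, l < j → j < i → DLie.antisymm f i j * DLie.antisymm f j l +
        DLie.antisymm f j l * DLie.antisymm f l i + DLie.antisymm f l i * DLie.antisymm f i j = 0 := by
      intro i j l hjl hij
      rw [antisymm_of_gt f hij, antisymm_of_gt f hjl, antisymm_of_lt f (hjl.trans hij),
        neg_mul_neg, hf.right l j i hjl hij]
      noncomm_ring
    rcases hij.lt_or_gt with h1 | h1 <;> rcases hjl.lt_or_gt with h2 | h2 <;>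
      rcases hil.lt_or_gt with h3 | h3
    · exact key i j l h1 h2
    · exact absurd (h1.trans h2) h3.not_gt
    · rw [← key' j l i h3 h2]; abel
    · rw [← key l i j h3 h1]; abel
    · rw [← key' l i j h1 h3]; abel
    · rw [← key j l i h2 h3]; abel
    · exact absurd (h2.trans h1) h3.not_gt
    · exact key' i j l h2 h1
  comm a b u v h1 h2 h3 h4 := by
    have key : ∀ a b u v : Fin n, a ≠ u → a ≠ v → b ≠ u → b ≠ v → a < b → u < v →
        DLie.antisymm f a b * DLie.antisymm f u v = DLie.antisymm f u v * DLie.antisymm f a b := by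
      intro a b u v h1 h2 h3 h4 hab huv
      rw [antisymm_of_lt f hab, antisymm_of_lt f huv]
      rcases le_total b v with h | h
      · rw [hf.comm a b u v hab huv h1 h2 h3 h4 h]
      · rw [hf.comm u v a b huv hab h1.symm h3.symm h2.symm h4.symm h]
    have hs : ∀ i j : Fin n, j < i → DLie.antisymm f i j = -DLie.antisymm f j i := fun i j h => by
      rw [antisymm_of_lt f h, antisymm_of_gt f h]
    rcases lt_trichotomy a b with hab | rfl | hab
    · rcases lt_trichotomy u v with huv | rfl | huv
      · exact key a b u v h1 h2 h3 h4 hab huv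
      · simp [antisymm_self]
      · simp [hs u v huv, key a b v u h2 h1 h4 h3 hab huv]
    · simp [antisymm_self]
    · rcases lt_trichotomy u v with huv | rfl | huv
      · simp [hs a b hab, key b a u v h3 h4 h1 h2 hab huv]
      · simp [antisymm_self]
      · simp [hs u v huv, hs a b hab, key b a v u h4 h3 h2 h1 hab huv]

/-- The generator `x_{ij}` of the algebra, for `i < j`. -/
noncomputable def genElt (k : Type u) [Field k] {n : ℕ} (i j : Fin n) : Alg (relations k n) :=
  if h : i < j then gen _ (x k h) else 0

theorem genElt_of_lt {i j : Fin n} (h : i < j) : genElt k i j = gen _ (x k h) := dif_pos h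

theorem isHalfRep_genElt : IsHalfRep (genElt k (n := n)) where
  left i j l hij hjl := by
    have h := quadLift_gen (R := relations k n) _
      (Submodule.subset_span (Or.inl (Or.inl ⟨i, j, l, hij, hjl, rfl⟩)))
    rw [map_sub, map_sub, quadLift_tmul, quadLift_tmul, quadLift_tmul, sub_sub, sub_eq_zero] at h
    rw [genElt_of_lt hij, genElt_of_lt hjl, genElt_of_lt (hij.trans hjl), h]
  right i j l hij hjl := by
    have h := quadLift_gen (R := relations k n) _
      (Submodule.subset_span (Or.inl (Or.inr ⟨i, j, l, hij, hjl, rfl⟩)))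
    rw [map_sub, map_sub, quadLift_tmul, quadLift_tmul, quadLift_tmul, sub_sub, sub_eq_zero] at h
    rw [genElt_of_lt hij, genElt_of_lt hjl, genElt_of_lt (hij.trans hjl), h]
  comm a b u v hab huv h1 h2 h3 h4 _ := by
    have h := quadLift_gen (R := relations k n) (x k hab ⊗ₜ x k huv - x k huv ⊗ₜ x k hab)
      (Submodule.subset_span (Or.inr ⟨a, b, u, v, hab, huv, by
        simp [h1.symm, h2.symm, h3.symm, h4.symm], rfl⟩))
    rw [map_sub, quadLift_tmul, quadLift_tmul, sub_eq_zero] at h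
    rw [genElt_of_lt hab, genElt_of_lt huv, h]

/-- The algebra homomorphism given by the images of the generators. -/
noncomputable def liftRep {B : Type*} [Ring B] [Algebra k B] (f : Fin n → Fin n → B)
    (hf : IsHalfRep f) : Alg (relations k n) →ₐ[k] B :=
  lift (genMap f) hf.quadLift_eq_zero

theorem liftRep_genElt {B : Type*} [Ring B] [Algebra k B] (f : Fin n → Fin n → B)
    (hf : IsHalfRep f) {i j : Fin n} (h : i < j) : liftRep (k := k) f hf (genElt k i j) = f i j := by
  rw [genElt_of_lt h, liftRep, lift_gen, genMap_x]

/-- A property of the generators that is linear holds for all elements of weight one. -/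
theorem gen_mem {S : Submodule k (Alg (relations k n))}
    (h : ∀ i j : Fin n, i < j → genElt k i j ∈ S) (v : Gen k n) : gen _ v ∈ S := by
  induction v using Finsupp.induction_linear with
  | zero => rw [map_zero]; exact S.zero_mem
  | add v w hv hw => rw [map_add]; exact S.add_mem hv hw
  | single q c =>
    have hq : Finsupp.single q c = c • x k q.2 := by simp [x]
    rw [hq, map_smul, ← genElt_of_lt]
    exact S.smul_mem _ (h _ _ q.2)

theorem algHom_ext_genElt {B : Type*} [Ring B] [Algebra k B]
    {f g : Alg (relations k n) →ₐ[k] B}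
    (h : ∀ i j : Fin n, i < j → f (genElt k i j) = g (genElt k i j)) : f = g :=
  algHom_ext (gen_mem (S := LinearMap.eqLocus f.toLinearMap g.toLinearMap) h)

theorem genElt_mem_weight {i j : Fin n} (h : i < j) : genElt k i j ∈ weight (relations k n) 1 := by
  rw [genElt_of_lt h]
  exact gen_mem_weight _

/-- In every relation each monomial has a factor carrying the largest index involved, so it vanishes
altogether once that index reaches `m`. -/
theorem isHalfRep_truncate {B : Type*} [Ring B] {f : Fin n → Fin n → B} (hf : IsHalfRep f)
    (m : ℕ) : IsHalfRep fun i j => if (j : ℕ) < m then f i j else 0 where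
  left i j l hij hjl := by
    by_cases h : (l : ℕ) < m
    · simp [h, (Fin.lt_def.1 hjl).trans h, hf.left i j l hij hjl]
    · simp [h]
  right i j l hij hjl := by
    by_cases h : (l : ℕ) < m
    · simp [h, (Fin.lt_def.1 hjl).trans h, hf.right i j l hij hjl]
    · simp [h]
  comm a b u v hab huv h1 h2 h3 h4 hbv := by
    by_cases h : (v : ℕ) < m
    · have h' : (b : ℕ) < m := (Fin.le_def.1 hbv).trans_lt h
      simp [h, h', hf.comm a b u v hab huv h1 h2 h3 h4 hbv]
    · simp [h]

/-- The endomorphism that maps the generators `x_{ij}` with `j ≥ m` to zero and fixes the other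
ones. -/
noncomputable def trunc (k : Type u) [Field k] (n m : ℕ) :
    Alg (relations k n) →ₐ[k] Alg (relations k n) :=
  liftRep _ (isHalfRep_truncate isHalfRep_genElt m)

theorem trunc_genElt (m : ℕ) {i j : Fin n} (h : i < j) :
    trunc k n m (genElt k i j) = if (j : ℕ) < m then genElt k i j else 0 :=
  liftRep_genElt _ _ h

end DLie

/-! ### Skew derivations on words -/

namespace DLie

open QuadAlg

section Words

variable {k : Type u} [Field k] {n : ℕ} {N : Type*} [AddCommGroup N] [Module k N]

variable (k n N) in
/-- Prepending a letter. -/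
noncomputable def consOp (c : Fin n) : Module.End k (List (Fin n) →₀ N) :=
  Finsupp.lmapDomain N k (c :: ·)

variable (k n N) in
/-- Removing a given first letter. -/
noncomputable def unconsOp (c : Fin n) : Module.End k (List (Fin n) →₀ N) :=
  Finsupp.lcomapDomain (c :: ·) (List.cons_injective)

theorem consOp_single (c : Fin n) (w : List (Fin n)) (a : N) :
    consOp k n N c (Finsupp.single w a) = Finsupp.single (c :: w) a :=
  Finsupp.mapDomain_single

theorem unconsOp_consOp (c d : Fin n) (v : List (Fin n) →₀ N) :
    unconsOp k n N c (consOp k n N d v) = if c = d then v else 0 := by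
  ext w
  change Finsupp.mapDomain (d :: ·) v (c :: w) = _
  split_ifs with h
  · subst h
    exact Finsupp.mapDomain_apply List.cons_injective v w
  · refine Finsupp.mapDomain_of_notMem_range _ _ ?_
    rintro ⟨w', hw⟩
    exact h (List.cons.inj hw).1.symm

theorem word_induction {P : (List (Fin n) →₀ N) → Prop} (h0 : P 0)
    (hadd : ∀ v w, P v → P w → P (v + w)) (hnil : ∀ a, P (Finsupp.single [] a))
    (hcons : ∀ c v, P v → P (consOp k n N c v)) (v) : P v := by
  induction v using Finsupp.induction_linear with
  | zero => exact h0
  | add v w hv hw => exact hadd v w hv hw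
  | single w a =>
    induction w with
    | nil => exact hnil a
    | cons c w ih => rw [← consOp_single (k := k)]; exact hcons c _ ih

/-- The action of `x_{ij}` on words with last letter in `N`. -/
noncomputable def wordOp (y : Fin n → Fin n → Module.End k N) (i j : Fin n) :
    List (Fin n) → N →ₗ[k] (List (Fin n) →₀ N)
  | [] => Finsupp.lsingle [] ∘ₗ y i j
  | c :: w => consOp k n N (Equiv.swap i j c) ∘ₗ wordOp y i j w
      + (if c = j then Finsupp.lsingle (j :: i :: w) else 0)
      - (if c = i then Finsupp.lsingle (i :: j :: w) else 0)

/-- The action of `x_{ij}` on words by a skew derivation: `x_{ij} j v = i (x_{ij} v) + j i v`,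
`x_{ij} i v = j (x_{ij} v) - i j v`, and `x_{ij}` commutes with the other letters. -/
noncomputable def skewOp (y : Fin n → Fin n → Module.End k N) (i j : Fin n) :
    Module.End k (List (Fin n) →₀ N) :=
  Finsupp.lsum k (wordOp y i j)

variable (y : Fin n → Fin n → Module.End k N)

theorem skewOp_nil (i j : Fin n) (a : N) :
    skewOp y i j (Finsupp.single [] a) = Finsupp.single [] (y i j a) := by
  simp [skewOp, wordOp]

theorem skewOp_consOp (i j c : Fin n) (v : List (Fin n) →₀ N) :
    skewOp y i j (consOp k n N c v) = consOp k n N (Equiv.swap i j c) (skewOp y i j v)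
      + (if c = j then consOp k n N j (consOp k n N i v) else 0)
      - (if c = i then consOp k n N i (consOp k n N j v) else 0) := by
  induction v using Finsupp.induction_linear with
  | zero => simp
  | add v w hv hw =>
    simp only [map_add, hv, hw]
    split_ifs <;> abel
  | single w a =>
    rw [consOp_single]
    simp only [skewOp, Finsupp.lsum_single, wordOp, consOp_single]
    split_ifs <;> simp

theorem skewOp_self {y : Fin n → Fin n → Module.End k N} (hy : IsRep y) (i : Fin n) :
    skewOp y i i = 0 := by
  refine LinearMap.ext fun v => ?_
  rw [LinearMap.zero_apply]
  induction v using word_induction (k := k) (n := n) (N := N) with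
  | h0 => simp
  | hadd v w hv hw => rw [map_add, hv, hw, add_zero]
  | hnil a => rw [skewOp_nil, hy.diag, LinearMap.zero_apply, Finsupp.single_zero]
  | hcons c v ih => rw [skewOp_consOp, ih, map_zero, zero_add, sub_self]

/-- Induction on the word. Moving a product past the first letter `c` applies the product of
transpositions to `c`. In the triple relation all three products give the same 3-cycle `i ↦ j ↦ l ↦
i`, so after the correction terms cancel there remains one letter followed by the relation on the
shorter word. For disjoint pairs the transpositions commute. -/
theorem isRep_skewOp {y : Fin n → Fin n → Module.End k N} (hy : IsRep y) : IsRep (skewOp y) where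
  swap i j := by
    refine LinearMap.ext fun v => ?_
    rw [LinearMap.neg_apply]
    induction v using word_induction (k := k) (n := n) (N := N) with
    | h0 => simp
    | hadd v w hv hw => rw [map_add, map_add, hv, hw, neg_add]
    | hnil a => rw [skewOp_nil, skewOp_nil, hy.swap, LinearMap.neg_apply, Finsupp.single_neg]
    | hcons c v ih =>
      rw [skewOp_consOp, skewOp_consOp, ih, map_neg, Equiv.swap_comm]
      abel
  diag := skewOp_self hy
  triple i j l hij hjl hil := by
    refine LinearMap.ext fun v => ?_
    simp only [LinearMap.add_apply, Module.End.mul_apply, LinearMap.zero_apply]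
    induction v using word_induction (k := k) (n := n) (N := N) with
    | h0 => simp
    | hadd v w hv hw =>
      simp only [map_add]
      -- The right-hand side is expanded as the sum of the relations on the two summands.
      rw [← add_zero (0 : List (Fin n) →₀ N)]
      nth_rewrite 1 [← hv]
      rw [← hw]
      abel
    | hnil a =>
      have h := LinearMap.congr_fun (hy.triple i j l hij hjl hil) a
      simp only [LinearMap.add_apply, Module.End.mul_apply, LinearMap.zero_apply] at h
      simp only [skewOp_nil, ← Finsupp.single_add, h, Finsupp.single_zero]
    | hcons c v ih =>
      have h := fun d => congrArg (consOp k n N d) ih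
      simp only [map_add, map_zero] at h
      rcases eq_or_ne c i with rfl | hci
      · simp [skewOp_consOp, Equiv.swap_apply_of_ne_of_ne, *, hij.symm, hjl.symm]
        rw [← h j]
        abel
      rcases eq_or_ne c j with rfl | hcj
      · simp [skewOp_consOp, Equiv.swap_apply_of_ne_of_ne, *, hij.symm, hjl.symm, hil.symm]
        rw [← h l]
        abel
      rcases eq_or_ne c l with rfl | hcl
      · simp [skewOp_consOp, Equiv.swap_apply_of_ne_of_ne, *, hij.symm, hjl.symm, hil.symm]
        rw [← h i]
        abel
      · simp [skewOp_consOp, Equiv.swap_apply_of_ne_of_ne, *]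
  comm a b p q h1 h2 h3 h4 := by
    rcases eq_or_ne a b with rfl | hab
    · rw [skewOp_self hy, zero_mul, mul_zero]
    rcases eq_or_ne p q with rfl | hpq
    · rw [skewOp_self hy, zero_mul, mul_zero]
    refine LinearMap.ext fun v => ?_
    simp only [Module.End.mul_apply]
    induction v using word_induction (k := k) (n := n) (N := N) with
    | h0 => simp
    | hadd v w hv hw => simp only [map_add, hv, hw]
    | hnil e =>
      have h := LinearMap.congr_fun (hy.comm a b p q h1 h2 h3 h4) e
      simp only [Module.End.mul_apply] at h
      simp only [skewOp_nil, h]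
    | hcons c v ih =>
      rcases eq_or_ne c a with rfl | hca
      · simp [skewOp_consOp, Equiv.swap_apply_of_ne_of_ne, *]
      rcases eq_or_ne c b with rfl | hcb
      · simp [skewOp_consOp, Equiv.swap_apply_of_ne_of_ne, *, hab.symm]
      rcases eq_or_ne c p with rfl | hcp
      · simp [skewOp_consOp, Equiv.swap_apply_of_ne_of_ne, *, h1.symm, h2.symm, h3.symm, h4.symm]
      rcases eq_or_ne c q with rfl | hcq
      · simp [skewOp_consOp, Equiv.swap_apply_of_ne_of_ne, *, h1.symm, h2.symm, h3.symm, h4.symm,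
          hpq.symm]
      · simp [skewOp_consOp, Equiv.swap_apply_of_ne_of_ne, *]

end Words

end DLie

namespace QuadAlg

variable {k : Type u} [Field k] {V : Type u} [AddCommGroup V] [Module k V]
  {R : Submodule k (V ⊗[k] V)}

theorem alg_induction {P : Alg R → Prop} (hC : ∀ c : k, P (algebraMap k _ c))
    (hgen : ∀ v, P (gen R v)) (hmul : ∀ a b, P a → P b → P (a * b))
    (hadd : ∀ a b, P a → P b → P (a + b)) (a) : P a := by
  obtain ⟨t, rfl⟩ := RingQuot.mkAlgHom_surjective k (Rel R) a
  induction t using TensorAlgebra.induction with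
  | algebraMap c => rw [AlgHom.commutes]; exact hC c
  | ι v => exact hgen v
  | mul a b ha hb => rw [map_mul]; exact hmul _ _ ha hb
  | add a b ha hb => rw [map_add]; exact hadd _ _ ha hb

end QuadAlg

namespace DLie

open QuadAlg

variable {k : Type u} [Field k] {n : ℕ}

theorem alg_induction {P : Alg (relations k n) → Prop} (hC : ∀ c : k, P (algebraMap k _ c))
    (hgen : ∀ i j : Fin n, i < j → P (genElt k i j)) (hmul : ∀ a b, P a → P b → P (a * b))
    (hadd : ∀ a b, P a → P b → P (a + b)) (a) : P a := by
  refine QuadAlg.alg_induction hC (fun v => ?_) hmul hadd a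
  induction v using Finsupp.induction_linear with
  | zero => rw [map_zero, ← map_zero (algebraMap k _)]; exact hC 0
  | add v w hv hw => rw [map_add]; exact hadd _ _ hv hw
  | single q c =>
    have hq : Finsupp.single q c = c • x k q.2 := by simp [x]
    rw [hq, map_smul, ← genElt_of_lt, Algebra.smul_def]
    exact hmul _ _ (hC c) (hgen _ _ q.2)

/-! ### The algebra acting on words, and coefficient maps -/

section Words

variable {A : Type*} [Ring A] [Algebra k A] (f : Fin n → Fin n → A)

variable (k) in
/-- The left multiplications by the generators. -/
noncomputable def leftMul (i j : Fin n) : Module.End k A :=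
  Algebra.lmul k A (antisymm f i j)

variable {f} in
theorem isRep_leftMul (hf : IsHalfRep f) : IsRep (leftMul k f) :=
  hf.antisymm.map (Algebra.lmul k A).toRingHom

theorem leftMul_apply {i j : Fin n} (h : i < j) (a : A) :
    leftMul k f i j a = f i j * a := by
  rw [leftMul, antisymm_of_lt _ h]
  rfl

variable (k) in
/-- The action of the generators on words: `x_{im}` prepends the letter `i`, the generators `x_{ij}`
with `j < m` act by skew derivations, and those with `j > m` act by zero. -/
noncomputable def levelOp (m i j : Fin n) :
    Module.End k (List (Fin n) →₀ A) :=
  if j < m then skewOp (leftMul k f) i j else if j = m then consOp k n _ i else 0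

variable {f} in
theorem isHalfRep_levelOp (hf : IsHalfRep f) (m : Fin n) : IsHalfRep (levelOp k f m) where
  left i j l hij hjl := by
    rcases lt_trichotomy l m with h | rfl | h
    · simp only [levelOp, h, hjl.trans h, if_true]
      exact (isRep_skewOp (isRep_leftMul hf)).isHalfRep.left i j l hij hjl
    -- With the top index equal to `m`, the relation is precisely the rule by which `x_{ij}` passes
    -- the letter `j`; in `right` below it is the rule for the letter `i`.
    · simp only [levelOp, hjl, lt_irrefl, if_true, if_false]
      refine LinearMap.ext fun v => ?_
      simp [skewOp_consOp, hij.ne', add_comm]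
    · simp [levelOp, h.not_gt, h.ne']
  right i j l hij hjl := by
    rcases lt_trichotomy l m with h | rfl | h
    · simp only [levelOp, h, hjl.trans h, if_true]
      exact (isRep_skewOp (isRep_leftMul hf)).isHalfRep.right i j l hij hjl
    · simp only [levelOp, hjl, lt_irrefl, if_true, if_false]
      refine LinearMap.ext fun v => ?_
      simp [skewOp_consOp, hij.ne]
    · simp [levelOp, h.not_gt, h.ne']
  comm a b u v hab huv h1 h2 h3 h4 hbv := by
    rcases lt_trichotomy v m with h | rfl | h
    · simp only [levelOp, h, hbv.trans_lt h, if_true]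
      exact (isRep_skewOp (isRep_leftMul hf)).comm a b u v h1 h2 h3 h4
    · simp only [levelOp, lt_of_le_of_ne hbv h4, lt_irrefl, if_true, if_false]
      refine LinearMap.ext fun w => ?_
      simp [skewOp_consOp, h1.symm, h3.symm, Equiv.swap_apply_of_ne_of_ne]
    · simp [levelOp, h.not_gt, h.ne']

variable (k) in
/-- The action of the algebra on words. -/
noncomputable def wordAct {f : Fin n → Fin n → A} (hf : IsHalfRep f) (m : Fin n) :
    Alg (relations k n) →ₐ[k] Module.End k (List (Fin n) →₀ A) :=
  liftRep _ (isHalfRep_levelOp hf m)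

theorem wordAct_genElt {f : Fin n → Fin n → A} (hf : IsHalfRep f) (m : Fin n) {i j : Fin n}
    (h : i < j) :
    wordAct k hf m (genElt k i j) = levelOp k f m i j :=
  liftRep_genElt _ _ h

/-- The product `x_{i₁ m} ⋯ x_{iᵣ m}`. -/
noncomputable def wordProd (m : Fin n) :
    List (Fin n) → A
  | [] => 1
  | c :: w => (if c < m then f c m else 0) * wordProd m w

variable (k) in
/-- The evaluation of words in the algebra. -/
noncomputable def wordEval (m : Fin n) :
    (List (Fin n) →₀ A) →ₗ[k] A :=
  Finsupp.lsum k fun w => LinearMap.mulLeft k (wordProd f m w)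

theorem wordEval_nil (m : Fin n) (a : A) :
    wordEval k f m (Finsupp.single [] a) = a := by
  simp [wordEval, wordProd]

theorem wordEval_consOp (m c : Fin n) (v : List (Fin n) →₀ A) :
    wordEval k f m (consOp k n _ c v) = (if c < m then f c m else 0) * wordEval k f m v := by
  induction v using Finsupp.induction_linear with
  | zero => simp
  | add v w hv hw => rw [map_add, map_add, hv, hw, map_add, mul_add]
  | single w a =>
    rw [consOp_single]
    simp [wordEval, wordProd, mul_assoc]

variable {f} in
theorem wordEval_skewOp (hf : IsHalfRep f) {m i j : Fin n} (hij : i < j) (hjm : j < m)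
    (v : List (Fin n) →₀ A) :
    wordEval k f m (skewOp (leftMul k f) i j v) = f i j * wordEval k f m v := by
  induction v using word_induction (k := k) (n := n) (N := A) with
  | h0 => simp
  | hadd v w hv hw => rw [map_add, map_add, hv, hw, map_add, mul_add]
  | hnil a => rw [skewOp_nil, wordEval_nil, wordEval_nil, leftMul_apply f hij]
  | hcons c v ih =>
    rw [skewOp_consOp, map_sub, map_add, wordEval_consOp, ih]
    have him := hij.trans hjm
    rcases eq_or_ne c i with rfl | hci
    · rw [if_neg hij.ne, if_pos rfl, wordEval_consOp, wordEval_consOp, wordEval_consOp,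
        Equiv.swap_apply_left, map_zero, add_zero, if_pos hjm, if_pos him, ← mul_assoc,
        hf.right c j m hij hjm]
      noncomm_ring
    rcases eq_or_ne c j with rfl | hcj
    · rw [if_neg hci, if_pos rfl, wordEval_consOp, wordEval_consOp, wordEval_consOp,
        Equiv.swap_apply_right, map_zero, sub_zero, if_pos hjm, if_pos him, ← mul_assoc,
        ← mul_assoc, ← mul_assoc, hf.left i c m hij hjm, add_mul, add_comm]
    · rw [if_neg hci, if_neg hcj, map_zero, sub_zero, add_zero, wordEval_consOp,
        Equiv.swap_apply_of_ne_of_ne hci hcj, ← mul_assoc, ← mul_assoc]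
      -- Letters `c ≥ m` evaluate to zero, which is consistent because the operator fixes them.
      split_ifs with hcm
      · rw [hf.comm i j c m hij hcm hci.symm him.ne hcj.symm hjm.ne hjm.le]
      · rw [zero_mul, mul_zero]

variable {f} (hf : IsHalfRep f)

/-- Evaluation intertwines the action with left multiplication, up to truncation because the
`x_{ij}` with `j > m` act by zero. -/
theorem wordEval_wordAct (m : Fin n) (a : Alg (relations k n)) (v) :
    wordEval k f m (wordAct k hf m a v) =
      liftRep (k := k) _ (isHalfRep_truncate hf (m + 1)) a * wordEval k f m v := by
  induction a using alg_induction generalizing v with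
  | hC c => simp [AlgHom.commutes, Module.algebraMap_end_apply, Algebra.smul_def]
  | hmul a b ha hb => rw [map_mul, map_mul, Module.End.mul_apply, ha, hb, mul_assoc]
  | hadd a b ha hb => rw [map_add, map_add, LinearMap.add_apply, map_add, ha, hb, add_mul]
  | hgen i j hij =>
    rw [wordAct_genElt hf m hij, liftRep_genElt (k := k) _ _ hij, levelOp]
    rcases lt_trichotomy j m with h | rfl | h
    · rw [if_pos h, if_pos (by omega), wordEval_skewOp hf hij h]
    · rw [if_neg (lt_irrefl _), if_pos rfl, if_pos (by omega), wordEval_consOp, if_pos hij]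
    · rw [if_neg h.not_gt, if_neg h.ne', if_neg (by omega), LinearMap.zero_apply, map_zero, zero_mul]

theorem wordAct_eq_zero (m : Fin n) (a : Alg (relations k n))
    (ha : trunc k n (m + 1) a = 0) : wordAct k hf m a = 0 := by
  have h : (wordAct k hf m).comp (trunc k n ((m : ℕ) + 1)) = wordAct k hf m := by
    refine algHom_ext_genElt (B := Module.End k (List (Fin n) →₀ A)) fun i j hij => ?_
    rw [AlgHom.comp_apply, trunc_genElt _ hij]
    split_ifs with h
    · rfl
    · rw [map_zero, wordAct_genElt hf m hij, levelOp, if_neg (by omega), if_neg (by omega)]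
  rw [← h, AlgHom.comp_apply, ha, map_zero]

variable (k) in
/-- The linear map that takes `∑ x_{im} aᵢ` to the truncation of `a_s`. -/
noncomputable def coeffAt (m s : Fin n) :
    Alg (relations k n) →ₗ[k] A :=
  wordEval k f m ∘ₗ unconsOp k n A s ∘ₗ
    LinearMap.applyₗ (Finsupp.single [] 1) ∘ₗ (wordAct k hf m).toLinearMap

theorem coeffAt_apply (m s : Fin n) (a : Alg (relations k n)) :
    coeffAt k hf m s a = wordEval k f m (unconsOp k n _ s (wordAct k hf m a (Finsupp.single [] 1))) :=
  rfl

/-- Acting on the empty word, `x_{tm}` prepends `t` to the word form of `a`; removing `s` detects `s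
= t`, and evaluation returns `a` truncated. This yields the right independence of the `x_{tm}`. -/
theorem coeffAt_mul {m s t : Fin n} (ht : t < m) (a : Alg (relations k n)) :
    coeffAt k hf m s (genElt k t m * a) =
      if s = t then liftRep (k := k) _ (isHalfRep_truncate hf (m + 1)) a else 0 := by
  rw [coeffAt_apply, map_mul, wordAct_genElt hf m ht, levelOp, if_neg (lt_irrefl _), if_pos rfl,
    Module.End.mul_apply, unconsOp_consOp]
  split_ifs
  · rw [wordEval_wordAct hf, wordEval_nil, mul_one]
  · rw [map_zero]

theorem coeffAt_eq_zero (m s : Fin n) (a : Alg (relations k n)) (ha : trunc k n (m + 1) a = 0) :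
    coeffAt k hf m s a = 0 := by
  rw [coeffAt_apply, wordAct_eq_zero hf m a ha, LinearMap.zero_apply, map_zero, map_zero]

end Words

/-! ### The chain of truncation ideals -/

theorem trunc_trunc {m m' : ℕ} (h : m ≤ m') (a : Alg (relations k n)) :
    trunc k n m (trunc k n m' a) = trunc k n m a := by
  have h : (trunc k n m).comp (trunc k n m') = trunc k n m := by
    refine algHom_ext_genElt fun i j hij => ?_
    rw [AlgHom.comp_apply, trunc_genElt _ hij, trunc_genElt _ hij]
    split_ifs with h1 h2 h2
    · rw [trunc_genElt _ hij, if_pos h2]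
    · rw [trunc_genElt _ hij, if_neg h2]
    · omega
    · rw [map_zero]
  exact DFunLike.congr_fun h a

theorem trunc_self (a : Alg (relations k n)) : trunc k n n a = a := by
  have h : trunc k n n = AlgHom.id k _ := by
    refine algHom_ext_genElt fun i j hij => ?_
    rw [trunc_genElt _ hij, if_pos j.2, AlgHom.id_apply]
  exact DFunLike.congr_fun h a

theorem trunc_zero (a : Alg (relations k n)) :
    trunc k n 0 a = algebraMap k _ (aug (relations k n) a) := by
  have h : trunc k n 0 = (Algebra.ofId k _).comp (aug (relations k n)) := by
    refine algHom_ext_genElt fun i j hij => ?_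
    rw [trunc_genElt _ hij, if_neg (Nat.not_lt_zero _), AlgHom.comp_apply, genElt_of_lt hij, aug_gen,
      map_zero]
  exact DFunLike.congr_fun h a

theorem trunc_mem_weight (m : ℕ) : ∀ i, ∀ a ∈ weight (relations k n) i,
    trunc k n m a ∈ weight (relations k n) i :=
  map_mem_weight <| gen_mem (S := (weight (relations k n) 1).comap (trunc k n m).toLinearMap)
    fun i j hij => by
      change trunc k n m (genElt k i j) ∈ weight (relations k n) 1
      rw [trunc_genElt _ hij]
      split_ifs
      · exact genElt_mem_weight hij
      · exact Submodule.zero_mem _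

/-- The right linear combinations of the `x_{sm}`. -/
noncomputable def topComb (k : Type u) [Field k] {n : ℕ} (m : Fin n) :
    ({s : Fin n // s < m} → Alg (relations k n)) →ₗ[k] Alg (relations k n) :=
  ∑ s, LinearMap.mulLeft k (genElt k s.1 m) ∘ₗ LinearMap.proj s

theorem topComb_apply (m : Fin n) (w : {s : Fin n // s < m} → Alg (relations k n)) :
    topComb k m w = ∑ s, genElt k s.1 m * w s := by
  simp [topComb]

/-- The part of weight `i + 1` of the right ideal generated by the `x_{sl}` with `l ≥ m`. -/
noncomputable def topIdeal (k : Type u) [Field k] {n : ℕ} (m : Fin n) (i : ℕ) :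
    Submodule k (Alg (relations k n)) :=
  (weight (relations k n) (i + 1) ⊓ LinearMap.ker (trunc k n (m + 1)).toLinearMap) ⊔
    (Submodule.pi Set.univ fun _ => weight (relations k n) i).map (topComb k m)

theorem genElt_mul_mem_topIdeal {m s : Fin n} (h : s < m) {i : ℕ} {a : Alg (relations k n)}
    (ha : a ∈ weight (relations k n) i) : genElt k s m * a ∈ topIdeal k m i := by
  refine Submodule.mem_sup_right ⟨Pi.single ⟨s, h⟩ a, ?_, ?_⟩
  · intro t _
    by_cases ht : t = ⟨s, h⟩
    · subst ht; simpa using ha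
    · rw [Pi.single_eq_of_ne ht]; exact Submodule.zero_mem _
  · rw [topComb_apply, Finset.sum_eq_single ⟨s, h⟩]
    · rw [Pi.single_eq_same]
    · intro t _ ht
      rw [Pi.single_eq_of_ne ht, mul_zero]
    · intro h'
      exact absurd (Finset.mem_univ _) h'

/-- The relations rewrite `x_{pq} x_{sm}` as a combination of products beginning with some `x_{tm}`,
so the right ideal absorbs left multiplication by `x_{pq}`. -/
theorem mul_mem_topIdeal {m p q : Fin n} (hpq : p < q) (hqm : q < m) {i : ℕ}
    {a : Alg (relations k n)} (ha : a ∈ topIdeal k m i) :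
    genElt k p q * a ∈ topIdeal k m (i + 1) := by
  have hmul : ∀ {s t : Fin n} {a : Alg (relations k n)}, s < t → a ∈ weight (relations k n) i →
      genElt k s t * a ∈ weight (relations k n) (i + 1) := fun h ha => by
    rw [add_comm]; exact mul_mem_weight _ _ _ _ (genElt_mem_weight h) ha
  obtain ⟨b, ⟨hb, hb0⟩, _, ⟨w, hw, rfl⟩, rfl⟩ := Submodule.mem_sup.1 ha
  rw [mul_add, topComb_apply, Finset.mul_sum]
  refine Submodule.add_mem _ (Submodule.mem_sup_left ⟨?_, ?_⟩) (Submodule.sum_mem _ fun s _ => ?_)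
  · rw [add_comm]
    exact mul_mem_weight _ _ _ _ (genElt_mem_weight hpq) hb
  · have hb0' : trunc k n (m + 1) b = 0 := hb0
    change trunc k n (m + 1) (genElt k p q * b) = 0
    rw [map_mul, hb0', mul_zero]
  · obtain ⟨s, hs⟩ := s
    have hws := hw ⟨s, hs⟩ (Set.mem_univ _)
    generalize w ⟨s, hs⟩ = a at hws
    rw [← mul_assoc]
    rcases eq_or_ne s p with rfl | hsp
    -- Here `right` is solved for its last term: `x_{pq} x_{pm} = x_{qm} x_{pq} - x_{pm} x_{qm}`.
    · have h := isHalfRep_genElt (k := k) |>.right s q m hpq hqm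
      rw [← sub_eq_iff_eq_add'] at h
      rw [← h, sub_mul, mul_assoc, mul_assoc]
      exact Submodule.sub_mem _ (genElt_mul_mem_topIdeal hqm (hmul hpq hws))
        (genElt_mul_mem_topIdeal hs (hmul hqm hws))
    rcases eq_or_ne s q with rfl | hsq
    · rw [isHalfRep_genElt.left p s m hpq hqm, add_mul, mul_assoc, mul_assoc]
      exact Submodule.add_mem _ (genElt_mul_mem_topIdeal hs (hmul (hpq.trans hs) hws))
        (genElt_mul_mem_topIdeal (hpq.trans hs) (hmul hpq hws))
    · rw [isHalfRep_genElt.comm p q s m hpq hs hsp.symm (hpq.trans hqm).ne hsq.symm hqm.ne hqm.le,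
        mul_assoc]
      exact genElt_mul_mem_topIdeal hs (hmul hpq hws)

theorem trunc_of_mem_weight_zero (m : ℕ) {a : Alg (relations k n)}
    (ha : a ∈ weight (relations k n) 0) : trunc k n m a = a := by
  rw [weight_zero, Submodule.mem_one] at ha
  obtain ⟨c, rfl⟩ := ha
  exact AlgHom.commutes _ _

theorem sub_trunc_mul_mem_topIdeal (m : Fin n) {p q : Fin n} (hpq : p < q) {i : ℕ}
    {a : Alg (relations k n)} (ha : a ∈ weight (relations k n) i)
    (h : q < m → genElt k p q * (a - trunc k n m a) ∈ topIdeal k m i) :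
    genElt k p q * a - trunc k n m (genElt k p q * a) ∈ topIdeal k m i := by
  rw [map_mul, trunc_genElt _ hpq]
  rcases lt_trichotomy q m with hqm | rfl | hqm
  · rw [if_pos (Fin.lt_def.1 hqm), ← mul_sub]
    exact h hqm
  · rw [if_neg (lt_irrefl _), zero_mul, sub_zero]
    exact genElt_mul_mem_topIdeal hpq ha
  · rw [if_neg (Fin.lt_def.1 hqm).not_gt, zero_mul, sub_zero]
    refine Submodule.mem_sup_left ⟨?_, ?_⟩
    · rw [add_comm]
      exact mul_mem_weight _ _ _ _ (genElt_mem_weight hpq) ha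
    · change trunc k n (m + 1) (genElt k p q * a) = 0
      rw [map_mul, trunc_genElt _ hpq, if_neg (by omega), zero_mul]

/-- Applied to `a` in `ker (trunc k n m)`, this gives the decomposition of `a` modulo `ker (trunc k
n (m + 1))` that the extension argument needs. -/
theorem sub_trunc_mem_topIdeal (m : Fin n) (i : ℕ) : ∀ a ∈ weight (relations k n) (i + 1),
    a - trunc k n m a ∈ topIdeal k m i := by
  induction i with
  | zero =>
    refine weight_succ_le (S := (topIdeal k m 0).comap
      (LinearMap.id - (trunc k n m).toLinearMap)) fun v a ha => ?_
    refine gen_mem (S := ((topIdeal k m 0).comap (LinearMap.id - (trunc k n m).toLinearMap)).comap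
      (LinearMap.mulRight k a)) (fun p q hpq => ?_) v
    refine sub_trunc_mul_mem_topIdeal m hpq ha fun _ => ?_
    rw [trunc_of_mem_weight_zero _ ha, sub_self, mul_zero]
    exact Submodule.zero_mem _
  | succ i ih =>
    refine weight_succ_le (S := (topIdeal k m (i + 1)).comap
      (LinearMap.id - (trunc k n m).toLinearMap)) fun v a ha => ?_
    refine gen_mem (S := ((topIdeal k m (i + 1)).comap
      (LinearMap.id - (trunc k n m).toLinearMap)).comap (LinearMap.mulRight k a))
      (fun p q hpq => ?_) v
    exact sub_trunc_mul_mem_topIdeal m hpq ha fun hqm => mul_mem_topIdeal hpq hqm (ih a ha)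

/-- Strong induction on `p` outside, descending induction on `m` inside: the step from `m + 1` to
`m` needs `m + 1` in degree `p` (`ih`) and in degree `p - 1` (`ihp`). -/
theorem isDiagonal_ker_trunc (p : ℕ) {m : ℕ} (hm : m ≤ n) :
    BarConstruction.IsDiagonal (aug (relations k n)) (weight (relations k n))
      (LinearMap.ker (trunc k n m).toLinearMap) p := by
  induction p using Nat.strong_induction_on generalizing m with
  | h p ihp =>
    induction hm using Nat.decreasingInduction with
    | self =>
      have h : LinearMap.ker (trunc k n n).toLinearMap = ⊥ :=
        LinearMap.ker_eq_bot'.2 fun a ha => by rw [← trunc_self a]; exact ha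
      rw [h]
      exact BarConstruction.isDiagonal_bot p
    | of_succ m hm ih =>
      refine BarConstruction.isDiagonal_ker (f := trunc k n m) (g := trunc k n (m + 1))
        mul_mem_weight (weight_zero (R := relations k n) ▸ Submodule.one_le.1 le_rfl)
        sub_aug_mem_weight aug_eq_zero_of_mem_weight (trunc_mem_weight _)
        (trunc_trunc le_rfl) ?_ (ι := {s : Fin n // s < ⟨m, hm⟩}) (fun s => genElt k s.1 ⟨m, hm⟩)
        (fun s => genElt_mem_weight s.2) ?_ ?_ ?_ (fun s => coeffAt k isHalfRep_genElt ⟨m, hm⟩ s.1)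
        ?_ (fun s => coeffAt_eq_zero isHalfRep_genElt ⟨m, hm⟩ s.1) ih (fun q hq => ihp q (by omega) hm)
      · intro a ha
        rw [← trunc_trunc m.le_succ, ha, map_zero]
      · intro s
        rw [trunc_genElt _ s.2, if_neg (lt_irrefl _)]
      · intro a ha h0
        rw [trunc_of_mem_weight_zero m ha] at h0
        rw [h0, map_zero]
      · intro i a ha h0
        have h := sub_trunc_mem_topIdeal ⟨m, hm⟩ i a ha
        rw [show trunc k n ((⟨m, hm⟩ : Fin n) : ℕ) a = 0 from h0, sub_zero] at h
        obtain ⟨b, ⟨hb, hb0⟩, _, ⟨w, hw, rfl⟩, rfl⟩ := Submodule.mem_sup.1 h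
        exact ⟨b, hb, hb0, w, fun s => hw s (Set.mem_univ _), by rw [topComb_apply]⟩
      · intro s t a
        rw [coeffAt_mul isHalfRep_genElt t.2]
        simp only [Subtype.ext_iff]
        -- With `f = genElt` the truncated lift in `coeffAt_mul` is `trunc k n (m + 1)` by
        -- definition.
        rfl

end DLie

theorem mainTheorem6 (k : Type u) [Field k] (hk : ringChar k ≠ 2) (n : ℕ) (hn : 2 ≤ n) :
    QuadAlg.IsKoszul (DLie.relations k n) := by
  intro p j hj
  refine BarConstruction.barCycles_inf_barWeight_le (fun p => ?_) hj
  have h : BarConstruction.augIdeal (QuadAlg.aug (DLie.relations k n)) =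
      LinearMap.ker (DLie.trunc k n 0).toLinearMap := by
    ext a
    change QuadAlg.aug _ a = 0 ↔ DLie.trunc k n 0 a = 0
    rw [DLie.trunc_zero]
    refine ⟨fun h => by rw [h, map_zero], fun h => ?_⟩
    -- The augmentation is a left inverse of the structure map from `k`, so a vanishing scalar in
    -- the algebra vanishes in `k`.
    have h' := congrArg (QuadAlg.aug (DLie.relations k n)) h
    rwa [AlgHom.commutes, map_zero] at h'
  rw [h]
  exact DLie.isDiagonal_ker_trunc p (Nat.zero_le n)
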